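/- **Individual verifiability of the Internet-based exam protocol Remark!, in a symbolic (applied $\pi$-calculus / ProVerif) model.** *Messages and attacker.* Messages are terms over names, public constants (channels $ch,bba,bbn$; roles $C,E$; $\mathsf{true}$), tuples, a free function $\mathit{correct}(q,a)$ (the right mark for answer $a$ to question $q$), and $pk,exp,encrypt,decrypt,sign,getmess,checksign,pseudo\_pub,pseudo\_priv,checkpseudo$, modulo $$\begin{aligned}&decrypt(encrypt(m,pk(k),r),k)=m,\quad decrypt(encrypt(m,pseudo\_pub(pk(k),e),r),pseudo\_priv(k,exp(e)))=m,\\ &checkpseudo(pseudo\_pub(pk(k),e),pseudo\_priv(k,exp(e)))=\mathsf{true},\quad getmess(sign(m,k))=m,\\ &checksign(sign(m,k),pk(k))=m,\quad checksign(sign(m,pseudo\_priv(k,exp(e))),pseudo\_pub(pk(k),e))=m.\end{aligned}$$ A Dolev–Yao attacker controls the public channels (network $ch$, bulletin board $bba,bbn$) but not private ones. *Protocol.* There are unboundedly many exams. Each has one exam authority (key $sk_A$, $pk_A=pk(sk_A)$), one mixnet (key $sk_N$, secret exponents $rc,re$), and unboundedly many candidates and examiners, whose public keys are registered in a table. All encryptions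 use fresh randomness. Write $i=\overline{PK}_C$ and $e=\overline{PK}_E$ for pseudonyms. On request for a role $R$, the mixnet takes a registered key $X$ of role $R$ and posts $(pseudo\_pub(X,x),exp(x),R)$ with its signature, where $x$ is the exponent registered with the key ($rc$ for candidates, $re$ for examiners), and sends $\{rc,Sign_N(rc)\}_{pk_A}$ to the authority; the tables are shared by all exams. A principal with secret key $k$ who recognises a pseudonym (via $checkpseudo$) uses $pseudo\_priv(k,exp(x))$ as private key. The authority generates $q$ and posts $\{q,Sign_A(q,i)\}_i$; the candidate answers $\{(q,a,i),Sign_C(q,a,i)\}_{pk_A}$; the authority posts the receipt $\{(q,a,i),Sign_A(q,a,i)\}_i$, and $\{T,Sign_A(T)\}_e$ with $T=(q,a,i,e)$; the examiner returns $\{M,Sign_E(M)\}_{pk_A}$ with $M=(T,Sign_A(T),m)$; the authority posts the notification $\{M,Sign_E(M)\}_i$ and finally publishes the entry $(q,a,\mathit{correct}(q,a))$ of the table of evaluations. Each recipient checks all signatures and the agreement of the data with what he already knows. The event $\mathit{generated}(q)$ is executed when the authority generates $q$; $\mathit{correct}(q,a,m)$ when the candidate accepts the mark $m$ at notification. *Tests.*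 Each honest candidate runs the test, to which she sends her data on a fresh private channel. The test executes the event $OK$ if all its checks succeed, and $KO$ as soon as one fails. - Question Validity (data $q$, private key; post $\{q',s\}_i$): $q'=q$ and $s$ is a signature by $pk_A$ on a pair $(q,\cdot)$. Executes $OK(q)$. - Marking Correctness (data $q,a,m$): waits for an entry $(q,a,m')$ in the table of evaluations and checks $m'=m$. Executes $OK(q,a,m)$. - Test Integrity (data private key, $q,a,i$; posts: examiner pseudonym $e$, receipt, notification): both posts decrypt, contain exactly $(q,a,i)$, resp. $(q,a,i,e)$, with valid signatures by $pk_A$, and the evaluation is signed under $e$. It executes $\mathit{accepted}$ with the data in the receipt once that signature is verified and $\mathit{marked}$ with the data signed in the evaluation once the examiner's signature is verified, and finally $OK(i,q,a)$. - Test Markedness: as Test Integrity, without the receipt and the event $\mathit{accepted}$. - Mark Integrity (inputs as for Test Markedness): the notification contains $(q,a,i,e)$ signed by $pk_A$, and the examiner signed $(q,a,i,e)$ with the mark $m$ of the notification. It executes $\mathit{assigned}$ with the data of the notification once the signature of $pk_A$ is verified, $\mathit{marked}$ with the data signed by the examiner once his signature is verified, and finally $OK(i,q,a,m)$. - Mark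 Notification Integrity (data private key, $m,i$; post: notification): the notification contains a tuple $(\cdot,\cdot,i,\cdot)$ signed by $pk_A$, and the mark $m$. It executes $\mathit{assigned}(i',m')$ with the data of the notification once that signature is verified, and finally $OK(i,m)$. *Settings.* Corrupted exam authorities and mixnets give their secrets to the attacker; if candidates or examiners are corrupted, the attacker registers further candidates or examiners with keys of his choice. In the soundness setting, the tests read the posts from the public channels. In the completeness setting all principals are honest (the protocol still runs over the attacker-controlled network), and the candidate passes the posts she received to the test on private channels. Honest examiners give either arbitrary fresh marks or the marks $\mathit{correct}(q,a)$. Write $e_1\leadsto e_2$ if, in every run, each execution of $e_1$ is preceded by an execution of $e_2$. **Theorem.** For all messages $i,q,a,m$ and both marking behaviours: 1. *Soundness.* For every choice of corrupted roles, except that the exam authority is honest in the first two items: - Question Validity: $OK(q)\leadsto \mathit{generated}(q)$. - Marking Correctness: $OK(q,a,m)\leadsto \mathit{correct}(q,a,m)$; moreover $\mathit{correct}(q,a)=m$ whenever $OK(q,a,m)$ is executed. - Test Integrity: $OK(i,q,a)\leadsto \mathit{marked}(i,q,a)$ and $OK(i,q,a)\leadsto \mathit{accepted}(i,q,a)$.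 - Test Markedness: $OK(i,q,a)\leadsto \mathit{marked}(i,q,a)$. - Mark Integrity: $OK(i,q,a,m)\leadsto \mathit{marked}(i,q,a,m)$ and $OK(i,q,a,m)\leadsto \mathit{assigned}(i,q,a,m)$. - Mark Notification Integrity: $OK(i,m)\leadsto \mathit{assigned}(i,m)$. 2. *Completeness.* In the completeness setting, for each of the six tests, no run executes $KO$, and some run executes $OK$. (For Marking Correctness, with examiners who give the marks $\mathit{correct}(q,a)$.) -/

import Mathlib

/-! Symbolic (applied pi-calculus / ProVerif style) model of the Remark! exam protocol and of its
individual verifiability-tests. -/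

namespace Remark

/-! ### Messages -/

/-- Public constants: the network channel, the two channels of the bulletin board, the roles
candidate and examiner, and the truth value `true`. -/
inductive Const
  | ch | bba | bbn | roleC | roleE | tt

/-- Terms over the signature of the protocol. `name n` are the names generated by `new`, `att n` the
attacker's own names. `correct` is the marking function; tuples of different arity are built by
different symbols. -/
inductive Term
  | name (n : ℕ)
  | att (n : ℕ)
  | const (c : Const)
  | pk (k : Term)
  | exp (r : Term)
  | encrypt (m k r : Term)
  | decrypt (c k : Term)
  | sign (m k : Term)
  | getmess (s : Term)
  | checksign (s k : Term)
  | pseudoPub (k r : Term)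
  | pseudoPriv (k h : Term)
  | checkPseudo (p k : Term)
  | correct (q a : Term)
  | tup2 (a b : Term)
  | tup3 (a b c : Term)
  | tup4 (a b c d : Term)

/-- The equational theory: the congruence generated by the equations for ElGamal encryption,
digital signatures and pseudonyms. -/
inductive Term.Eqv : Term → Term → Prop
  | refl (t) : Eqv t t
  | symm {t u} : Eqv t u → Eqv u t
  | trans {t u v} : Eqv t u → Eqv u v → Eqv t v
  | decrypt_pk (m k r) : Eqv (decrypt (encrypt m (pk k) r) k) m
  | decrypt_pseudo (m k e r) :
      Eqv (decrypt (encrypt m (pseudoPub (pk k) e) r) (pseudoPriv k (exp e))) m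
  | check_pseudo (k e) :
      Eqv (checkPseudo (pseudoPub (pk k) e) (pseudoPriv k (exp e))) (const .tt)
  | getmess_sign (m k) : Eqv (getmess (sign m k)) m
  | checksign_pk (m k) : Eqv (checksign (sign m k) (pk k)) m
  | checksign_pseudo (m k e) :
      Eqv (checksign (sign m (pseudoPriv k (exp e))) (pseudoPub (pk k) e)) m
  | cpk {k k'} : Eqv k k' → Eqv (pk k) (pk k')
  | cexp {r r'} : Eqv r r' → Eqv (exp r) (exp r')
  | cencrypt {m m' k k' r r'} : Eqv m m' → Eqv k k' → Eqv r r' →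
      Eqv (encrypt m k r) (encrypt m' k' r')
  | cdecrypt {c c' k k'} : Eqv c c' → Eqv k k' → Eqv (decrypt c k) (decrypt c' k')
  | csign {m m' k k'} : Eqv m m' → Eqv k k' → Eqv (sign m k) (sign m' k')
  | cgetmess {s s'} : Eqv s s' → Eqv (getmess s) (getmess s')
  | cchecksign {s s' k k'} : Eqv s s' → Eqv k k' → Eqv (checksign s k) (checksign s' k')
  | cpseudoPub {k k' r r'} : Eqv k k' → Eqv r r' → Eqv (pseudoPub k r) (pseudoPub k' r')
  | cpseudoPriv {k k' h h'} : Eqv k k' → Eqv h h' → Eqv (pseudoPriv k h) (pseudoPriv k' h')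
  | ccheckPseudo {p p' k k'} : Eqv p p' → Eqv k k' → Eqv (checkPseudo p k) (checkPseudo p' k')
  | ccorrect {q q' a a'} : Eqv q q' → Eqv a a' → Eqv (correct q a) (correct q' a')
  | ctup2 {a a' b b'} : Eqv a a' → Eqv b b' → Eqv (tup2 a b) (tup2 a' b')
  | ctup3 {a a' b b' c c'} : Eqv a a' → Eqv b b' → Eqv c c' → Eqv (tup3 a b c) (tup3 a' b' c')
  | ctup4 {a a' b b' c c' d d'} : Eqv a a' → Eqv b b' → Eqv c c' → Eqv d d' →
      Eqv (tup4 a b c d) (tup4 a' b' c' d')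

instance termSetoid : Setoid Term where
  r := Term.Eqv
  iseqv := ⟨Term.Eqv.refl, Term.Eqv.symm, Term.Eqv.trans⟩

/-- Messages: terms modulo the equational theory. -/
def Msg : Type := Quotient termSetoid

namespace Msg

def mk (t : Term) : Msg := Quotient.mk termSetoid t

def name (n : ℕ) : Msg := mk (.name n)
def att (n : ℕ) : Msg := mk (.att n)
def const (c : Const) : Msg := mk (.const c)
def pk : Msg → Msg := Quotient.map Term.pk fun _ _ h => .cpk h
def exp : Msg → Msg := Quotient.map Term.exp fun _ _ h => .cexp h
def getmess : Msg → Msg := Quotient.map Term.getmess fun _ _ h => .cgetmess h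
def decrypt : Msg → Msg → Msg := Quotient.map₂ Term.decrypt fun _ _ h _ _ h' => .cdecrypt h h'
def sign : Msg → Msg → Msg := Quotient.map₂ Term.sign fun _ _ h _ _ h' => .csign h h'
def checksign : Msg → Msg → Msg :=
  Quotient.map₂ Term.checksign fun _ _ h _ _ h' => .cchecksign h h'
def pseudoPub : Msg → Msg → Msg :=
  Quotient.map₂ Term.pseudoPub fun _ _ h _ _ h' => .cpseudoPub h h'
def pseudoPriv : Msg → Msg → Msg :=
  Quotient.map₂ Term.pseudoPriv fun _ _ h _ _ h' => .cpseudoPriv h h'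
def checkPseudo : Msg → Msg → Msg :=
  Quotient.map₂ Term.checkPseudo fun _ _ h _ _ h' => .ccheckPseudo h h'
def correct : Msg → Msg → Msg := Quotient.map₂ Term.correct fun _ _ h _ _ h' => .ccorrect h h'
def tup2 : Msg → Msg → Msg := Quotient.map₂ Term.tup2 fun _ _ h _ _ h' => .ctup2 h h'
noncomputable def encrypt (m k r : Msg) : Msg :=
  mk (.encrypt (Quotient.out m) (Quotient.out k) (Quotient.out r))
noncomputable def tup3 (a b c : Msg) : Msg :=
  mk (.tup3 (Quotient.out a) (Quotient.out b) (Quotient.out c))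
noncomputable def tup4 (a b c d : Msg) : Msg :=
  mk (.tup4 (Quotient.out a) (Quotient.out b) (Quotient.out c) (Quotient.out d))

theorem out_eqv (t : Term) : Term.Eqv (Quotient.out (mk t)) t := Quotient.mk_out (s := termSetoid) t

theorem encrypt_mk (m k r : Term) : encrypt (mk m) (mk k) (mk r) = mk (.encrypt m k r) :=
  Quotient.sound (.cencrypt (out_eqv m) (out_eqv k) (out_eqv r))

theorem tup3_mk (a b c : Term) : tup3 (mk a) (mk b) (mk c) = mk (.tup3 a b c) :=
  Quotient.sound (.ctup3 (out_eqv a) (out_eqv b) (out_eqv c))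

theorem tup4_mk (a b c d : Term) : tup4 (mk a) (mk b) (mk c) (mk d) = mk (.tup4 a b c d) :=
  Quotient.sound (.ctup4 (out_eqv a) (out_eqv b) (out_eqv c) (out_eqv d))

end Msg

open Msg

/-- What the attacker can compute from the messages in `K`: he knows the public constants and his
own names, applies every function symbol and takes tuples apart. -/
inductive Derives (K : Set Msg) : Msg → Prop
  | known {m} : m ∈ K → Derives K m
  | att (n) : Derives K (att n)
  | const (c) : Derives K (const c)
  | pk {k} : Derives K k → Derives K (pk k)
  | exp {r} : Derives K r → Derives K (exp r)
  | encrypt {m k r} : Derives K m → Derives K k → Derives K r → Derives K (encrypt m k r)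
  | decrypt {c k} : Derives K c → Derives K k → Derives K (decrypt c k)
  | sign {m k} : Derives K m → Derives K k → Derives K (sign m k)
  | getmess {s} : Derives K s → Derives K (getmess s)
  | checksign {s k} : Derives K s → Derives K k → Derives K (checksign s k)
  | pseudoPub {k r} : Derives K k → Derives K r → Derives K (pseudoPub k r)
  | pseudoPriv {k h} : Derives K k → Derives K h → Derives K (pseudoPriv k h)
  | checkPseudo {p k} : Derives K p → Derives K k → Derives K (checkPseudo p k)
  | correct {q a} : Derives K q → Derives K a → Derives K (correct q a)
  | tup2 {a b} : Derives K a → Derives K b → Derives K (tup2 a b)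
  | tup3 {a b c} : Derives K a → Derives K b → Derives K c → Derives K (tup3 a b c)
  | tup4 {a b c d} : Derives K a → Derives K b → Derives K c → Derives K d →
      Derives K (tup4 a b c d)
  | proj2₁ {a b} : Derives K (Msg.tup2 a b) → Derives K a
  | proj2₂ {a b} : Derives K (Msg.tup2 a b) → Derives K b
  | proj3₁ {a b c} : Derives K (Msg.tup3 a b c) → Derives K a
  | proj3₂ {a b c} : Derives K (Msg.tup3 a b c) → Derives K b
  | proj3₃ {a b c} : Derives K (Msg.tup3 a b c) → Derives K c
  | proj4₁ {a b c d} : Derives K (Msg.tup4 a b c d) → Derives K a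
  | proj4₂ {a b c d} : Derives K (Msg.tup4 a b c d) → Derives K b
  | proj4₃ {a b c d} : Derives K (Msg.tup4 a b c d) → Derives K c
  | proj4₄ {a b c d} : Derives K (Msg.tup4 a b c d) → Derives K d

/-! ### Processes and their semantics -/

inductive EventName
  | OK | KO | generated | correct | accepted | marked | assigned

/-- An event with its arguments. -/
structure Event where
  label : EventName
  args : List Msg

/-- The tables: `publickey(role, exponent, public key)` and `correct_ans(question, answer, mark)`. -/
inductive Table
  | publickey | correctAns

/-- Processes. Binders are functions on messages. The guards `φ` used below are conjunctions of
equalities of messages. -/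
inductive Proc
  | nil
  | par (P Q : Proc)
  | repl (P : Proc)
  | new (P : Msg → Proc)
  | inp (c : Msg) (P : Msg → Proc)
  | out (c m : Msg) (P : Proc)
  /-- `if φ then P else Q` -/
  | cond (φ : Prop) (P Q : Proc)
  /-- `let (a, b) = m in P a b else Q` -/
  | let2 (m : Msg) (P : Msg → Msg → Proc) (Q : Proc)
  | let3 (m : Msg) (P : Msg → Msg → Msg → Proc) (Q : Proc)
  | let4 (m : Msg) (P : Msg → Msg → Msg → Msg → Proc) (Q : Proc)
  | event (e : Event) (P : Proc)
  /-- `insert t(a, b, c); P` -/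
  | insert (t : Table) (a b c : Msg) (P : Proc)
  /-- `get t(a, b, c) suchthat φ a b c in P a b c` -/
  | get (t : Table) (φ : Msg → Msg → Msg → Prop) (P : Msg → Msg → Msg → Proc)

/-- A configuration: the number of names generated so far, the running processes, the table entries,
the messages the attacker has received, and the events executed so far, latest first. -/
structure Config where
  next : ℕ
  procs : Multiset Proc
  tables : Set (Table × Msg × Msg × Msg)
  known : Set Msg
  log : List Event

/-- One step of a configuration. The attacker receives every message sent on, and sends arbitrary
derivable messages to, every channel that he can derive. -/
inductive Step : Config → Config → Prop
  | nil {n S T K L} : Step ⟨n, .nil ::ₘ S, T, K, L⟩ ⟨n, S, T, K, L⟩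
  | par {n S T K L P Q} : Step ⟨n, .par P Q ::ₘ S, T, K, L⟩ ⟨n, P ::ₘ Q ::ₘ S, T, K, L⟩
  | repl {n S T K L P} : Step ⟨n, .repl P ::ₘ S, T, K, L⟩ ⟨n, P ::ₘ .repl P ::ₘ S, T, K, L⟩
  | new {n S T K L P} :
      Step ⟨n, .new P ::ₘ S, T, K, L⟩ ⟨n + 1, P (Msg.name n) ::ₘ S, T, K, L⟩
  | comm {n S T K L c m P Q} :
      Step ⟨n, .out c m P ::ₘ .inp c Q ::ₘ S, T, K, L⟩ ⟨n, P ::ₘ Q m ::ₘ S, T, K, L⟩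
  | recv {n S T K L c m P} : Derives K c →
      Step ⟨n, .out c m P ::ₘ S, T, K, L⟩ ⟨n, P ::ₘ S, T, insert m K, L⟩
  | send {n S T K L c m P} : Derives K c → Derives K m →
      Step ⟨n, .inp c P ::ₘ S, T, K, L⟩ ⟨n, P m ::ₘ S, T, K, L⟩
  | cond_true {n S T K L P Q} {φ : Prop} : φ →
      Step ⟨n, .cond φ P Q ::ₘ S, T, K, L⟩ ⟨n, P ::ₘ S, T, K, L⟩
  | cond_false {n S T K L P Q} {φ : Prop} : ¬ φ →
      Step ⟨n, .cond φ P Q ::ₘ S, T, K, L⟩ ⟨n, Q ::ₘ S, T, K, L⟩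
  | let2 {n S T K L m P Q a b} : m = tup2 a b →
      Step ⟨n, .let2 m P Q ::ₘ S, T, K, L⟩ ⟨n, P a b ::ₘ S, T, K, L⟩
  | let2_else {n S T K L m P Q} : (∀ a b, m ≠ tup2 a b) →
      Step ⟨n, .let2 m P Q ::ₘ S, T, K, L⟩ ⟨n, Q ::ₘ S, T, K, L⟩
  | let3 {n S T K L m P Q a b c} : m = tup3 a b c →
      Step ⟨n, .let3 m P Q ::ₘ S, T, K, L⟩ ⟨n, P a b c ::ₘ S, T, K, L⟩
  | let3_else {n S T K L m P Q} : (∀ a b c, m ≠ tup3 a b c) →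
      Step ⟨n, .let3 m P Q ::ₘ S, T, K, L⟩ ⟨n, Q ::ₘ S, T, K, L⟩
  | let4 {n S T K L m P Q a b c d} : m = tup4 a b c d →
      Step ⟨n, .let4 m P Q ::ₘ S, T, K, L⟩ ⟨n, P a b c d ::ₘ S, T, K, L⟩
  | let4_else {n S T K L m P Q} : (∀ a b c d, m ≠ tup4 a b c d) →
      Step ⟨n, .let4 m P Q ::ₘ S, T, K, L⟩ ⟨n, Q ::ₘ S, T, K, L⟩
  | event {n S T K L e P} : Step ⟨n, .event e P ::ₘ S, T, K, L⟩ ⟨n, P ::ₘ S, T, K, e :: L⟩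
  | insert {n S T K L t a b c P} :
      Step ⟨n, .insert t a b c P ::ₘ S, T, K, L⟩ ⟨n, P ::ₘ S, insert (t, a, b, c) T, K, L⟩
  | get {n S T K L t a b c P} {φ : Msg → Msg → Msg → Prop} : (t, a, b, c) ∈ T → φ a b c →
      Step ⟨n, .get t φ P ::ₘ S, T, K, L⟩ ⟨n, P a b c ::ₘ S, T, K, L⟩

/-- The configurations that can be reached when the closed process `P` runs in presence of the
attacker. -/
def Reaches (P : Proc) (s : Config) : Prop :=
  Relation.ReflTransGen Step ⟨0, {P}, ∅, ∅, []⟩ s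

/-- The correspondence assertion `e ⇝ e'`: whenever `e` is executed, `e'` was executed before. -/
def Corresponds (P : Proc) (e e' : Event) : Prop :=
  ∀ s, Reaches P s → ∀ l₁ l₂, s.log = l₁ ++ e :: l₂ → e' ∈ l₂

/-- Some run of `P` executes an event named `l`. -/
def Executes (P : Proc) (l : EventName) : Prop :=
  ∃ s, Reaches P s ∧ ∃ e ∈ s.log, e.label = l

/-! ### The principals -/

def ch : Msg := const .ch
def bba : Msg := const .bba
def bbn : Msg := const .bbn
def roleC : Msg := const .roleC
def roleE : Msg := const .roleE

/-- The mixnet. -/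
noncomputable def NET (skN pkA rc : Msg) : Proc :=
  .inp ch fun R =>
  .get .publickey (fun R' _ _ => R' = R) fun _ rx pkX =>
  .out bbn (tup4 (pseudoPub pkX rx) (exp rx) R (sign (tup3 (pseudoPub pkX rx) (exp rx) R) skN)) <|
  .new fun r =>
  .out ch (encrypt (tup2 rc (sign rc skN)) pkA r) .nil

/-- The exam authority. It generates a question, collects a test, distributes it, notifies the mark,
and finally publishes the entry of the table of evaluations for the collected test. -/
noncomputable def EA (skA pkN : Msg) : Proc :=
  .new fun ques =>
  .event ⟨.generated, [ques]⟩ <|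
  -- preparation
  .inp bbn fun x => .let4 x (fun pseudoC hc r spseC =>
  .cond (tup3 pseudoC hc r = checksign spseC pkN ∧ r = roleC)
    -- testing
    (.new fun r₁ =>
    .out bba (encrypt (tup2 ques (sign (tup2 ques pseudoC) skA)) pseudoC r₁) <|
    .inp ch fun eca => .let2 (decrypt eca skA) (fun ca₀ sca => .let3 ca₀ (fun q ans p =>
    .cond (q = ques ∧ p = pseudoC ∧ tup3 ques ans pseudoC = checksign sca pseudoC)
      (.new fun r₂ =>
      .out bba (encrypt (tup2 (tup3 ques ans pseudoC) (sign (tup3 ques ans pseudoC) skA))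
        pseudoC r₂) <|
      -- marking
      .inp bbn fun y => .let4 y (fun pseudoE he role spseE =>
      .cond (tup3 pseudoE he role = checksign spseE pkN ∧ role = roleE)
        (let ca := tup4 ques ans pseudoC pseudoE
        let sca' := sign ca skA
        .new fun r₃ =>
        .out bba (encrypt (tup2 ca sca') pseudoE r₃) <|
        .inp ch fun ema => .let2 (decrypt ema skA) (fun ma sma => .let3 ma (fun ca' sca'' mark =>
        .cond (ca' = ca ∧ sca'' = sca' ∧ tup3 ca sca' mark = checksign sma pseudoE)
          -- notification
          (.new fun r₄ =>
          .out bba (encrypt (tup2 (tup3 ca sca' mark) sma) pseudoC r₄) <|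
          .inp ch fun _ =>
          .insert .correctAns ques ans (correct ques ans) <|
          .out bba (tup3 ques ans (correct ques ans)) .nil)
          .nil) .nil) .nil)
        .nil) .nil)
      .nil) .nil) .nil)
    .nil) .nil

/-- How honest examiners mark: with an arbitrary (fresh) mark, or with the correct one. -/
inductive Marking
  | arbitrary | correct

/-- The mark that an examiner with fresh mark `mark` gives to the test `(q, a)`. -/
def Marking.give : Marking → (mark q a : Msg) → Msg
  | .arbitrary, mark, _, _ => mark
  | .correct, _, q, a => Msg.correct q a

/-- The examiner. -/
noncomputable def Ex (ρ : Marking) (skE pkA pkN mark : Msg) : Proc :=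
  -- preparation
  .inp bbn fun x => .let4 x (fun pseudoE he _ spseE =>
  .cond (tup3 pseudoE he roleE = checksign spseE pkN)
    (let privE := pseudoPriv skE he
    .cond (checkPseudo pseudoE privE = const .tt)
      -- marking
      (.inp bba fun eca => .let2 (decrypt eca privE) (fun ca sca => .let4 ca (fun ques ans pseudoC p =>
      .cond (p = pseudoE ∧ tup4 ques ans pseudoC pseudoE = checksign sca pkA)
        (let ma := tup3 (tup4 ques ans pseudoC pseudoE) sca (ρ.give mark ques ans)
        .new fun r =>
        .out ch (encrypt (tup2 ma (sign ma privE)) pkA r) .nil)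
        .nil) .nil) .nil)
      .nil)
    .nil) .nil

/-- The perspective of a candidate at the end of the exam: her private key and pseudonym, the
question, answer and mark, and the messages of the bulletin board that she received. -/
structure View where
  (privC pseudoC ques ans mark eques receipt notif pseudoE he role spseE : Msg)

/-- What a candidate does for the verifiability-test, when she has received the question, when she
has submitted her test, and when she has been notified. -/
structure Report where
  question : (privC ques eques : Msg) → Proc := fun _ _ _ => .nil
  submission : (privC pseudoC ques ans : Msg) → Proc := fun _ _ _ _ => .nil
  notification : View → Proc := fun _ => .nil

/-- The candidate. -/
noncomputable def Cand (R : Report) (skC pkA pkN ans : Msg) : Proc :=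
  -- preparation
  .inp bbn fun x => .let4 x (fun pseudoC hc r spseC =>
  .cond (tup3 pseudoC hc r = checksign spseC pkN ∧ r = roleC)
    (let privC := pseudoPriv skC hc
    .cond (checkPseudo pseudoC privC = const .tt)
      -- testing
      (.inp bba fun eques => .let2 (decrypt eques privC) (fun ques sques =>
      .cond (tup2 ques pseudoC = checksign sques pkA)
        (.par (R.question privC ques eques) <|
        let ca := tup3 ques ans pseudoC
        .new fun r₁ =>
        .out ch (encrypt (tup2 ca (sign ca privC)) pkA r₁) <|
        .par (R.submission privC pseudoC ques ans) <|
        .inp bba fun eca' => .let2 (decrypt eca' privC) (fun ca' sca' =>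
        .cond (ca' = ca ∧ ca = checksign sca' pkA)
          -- notification
          (.inp bba fun ema' =>
          .inp bbn fun y => .let4 y (fun pseudoE he role spseE =>
          .cond (tup3 pseudoE he roleE = checksign spseE pkN)
            (.let2 (decrypt ema' privC) (fun ma sma => .let3 ma (fun ca'' sca'' mark =>
            .cond (ca'' = tup4 ques ans pseudoC pseudoE ∧ ca'' = checksign sca'' pkA ∧
                tup3 (tup4 ques ans pseudoC pseudoE) sca'' mark = checksign sma pseudoE)
              (.event ⟨.correct, [ques, ans, mark]⟩ <|
              R.notification
                ⟨privC, pseudoC, ques, ans, mark, eques, eca', ema', pseudoE, he, role, spseE⟩)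
              .nil) .nil) .nil)
            .nil) .nil)
          .nil) .nil)
        .nil) .nil)
      .nil)
    .nil) .nil

/-! ### The exam -/

/-- Which roles are corrupted. A corrupted exam authority or mixnet hands its secrets to the
attacker; if candidates or examiners are corrupted, the attacker registers keys of his choice as
candidates or examiners, besides the honest ones. -/
structure Corruption where
  (ea net examiners candidates : Bool)

/-- All principals are honest. -/
def Corruption.none : Corruption := ⟨false, false, false, false⟩

/-- The exam process: an unbounded number of exams, each with one exam authority, one mixnet, and
unbounded numbers of candidates and examiners. Registered honest candidates run `cand skC pkA pkN ans`. -/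
noncomputable def exam (κ : Corruption) (ρ : Marking) (cand : Msg → Msg → Msg → Msg → Proc) : Proc :=
  .repl <|
  .new fun rc => .new fun re =>
  .new fun skA => .out ch (pk skA) <|
  .new fun skN => .out ch (pk skN) <|
  .par (if κ.net then .out ch (tup3 skN rc re) .nil else .repl (NET skN (pk skA) rc)) <|
  .par (if κ.ea then .out ch skA .nil else .repl (EA skA (pk skN))) <|
  .par (.repl (.new fun skC => .out ch (pk skC) <| .new fun ans =>
    .insert .publickey roleC rc (pk skC) <| cand skC (pk skA) (pk skN) ans)) <|
  .par (.repl (.new fun skE => .out ch (pk skE) <| .new fun mark =>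
    .insert .publickey roleE re (pk skE) <| Ex ρ skE (pk skA) (pk skN) mark)) <|
  .par (if κ.candidates then .repl (.inp ch fun pkX => .insert .publickey roleC rc pkX .nil)
    else .nil)
    (if κ.examiners then .repl (.inp ch fun pkX => .insert .publickey roleE re pkX .nil)
    else .nil)

/-! ### The verifiability-tests

The arguments are the exam authority's key, the private channel from the candidate, and the channels
from which the posts of the mixnet and of the exam authority on the bulletin board are read. Every
failing check ends in `KO`. -/

def OK (args : List Msg) : Proc := .event ⟨.OK, args⟩ .nil
def KO : Proc := .event ⟨.KO, []⟩ .nil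

noncomputable def testQV (pkA pch _bn ba : Msg) : Proc :=
  .inp ba fun eques =>
  .inp pch fun x => .let2 x (fun ques privC =>
  .let2 (decrypt eques privC) (fun ques' sques =>
  .let2 (checksign sques pkA) (fun ques'' _pseudoC =>
  .cond (ques' = ques ∧ ques'' = ques') (OK [ques]) KO) KO) KO) KO

noncomputable def testMC (_pkA pch _bn _ba : Msg) : Proc :=
  .inp pch fun x => .let3 x (fun ques ans mark =>
  .get .correctAns (fun q a _ => q = ques ∧ a = ans) fun _ _ mark' =>
  .cond (mark' = mark) (OK [ques, ans, mark]) KO) KO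

/-- The receipt belongs to `Accepted` once its signature by the exam authority is checked, the
notification to `Marked` once its signature by the examiner is checked. -/
noncomputable def testTI (pkA pch bn ba : Msg) : Proc :=
  .inp pch fun x => .let4 x (fun privC ques ans pseudoC =>
  .inp bn fun y => .let4 y (fun pseudoE _he _role _spseE =>
  .inp ba fun eca =>
  .inp ba fun ema =>
  .let2 (decrypt eca privC) (fun _ca sca =>
  .let3 (checksign sca pkA) (fun q₁ a₁ p₁ =>
  .event ⟨.accepted, [p₁, q₁, a₁]⟩ <|
  .let2 (decrypt ema privC) (fun ma sma => .let3 ma (fun ca₂ sca₂ _mark => .let4 ca₂ (fun q₂ a₂ p₂ e₂ =>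
  .let3 (checksign sma pseudoE) (fun ca₃ sca₃ _mark' => .let4 ca₃ (fun q₃ a₃ p₃ e₃ =>
  .event ⟨.marked, [p₃, q₃, a₃]⟩ <|
  .cond (q₁ = ques ∧ a₁ = ans ∧ p₁ = pseudoC ∧ q₂ = ques ∧ a₂ = ans ∧ p₂ = pseudoC ∧ e₂ = pseudoE ∧
      tup4 q₂ a₂ p₂ e₂ = checksign sca₂ pkA ∧ q₃ = ques ∧ a₃ = ans ∧ p₃ = pseudoC ∧ e₃ = pseudoE ∧
      sca₃ = sca₂)
    (OK [pseudoC, ques, ans]) KO) KO) KO) KO) KO) KO) KO) KO) KO) KO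

noncomputable def testTM (pkA pch bn ba : Msg) : Proc :=
  .inp pch fun x => .let4 x (fun privC ques ans pseudoC =>
  .inp bn fun y => .let4 y (fun pseudoE _he _role _spseE =>
  .inp ba fun ema =>
  .let2 (decrypt ema privC) (fun ma sma => .let3 ma (fun ca₂ sca₂ _mark => .let4 ca₂ (fun q₂ a₂ p₂ e₂ =>
  .let3 (checksign sma pseudoE) (fun ca₃ sca₃ _mark' => .let4 ca₃ (fun q₃ a₃ p₃ e₃ =>
  .event ⟨.marked, [p₃, q₃, a₃]⟩ <|
  .cond (q₂ = ques ∧ a₂ = ans ∧ p₂ = pseudoC ∧ e₂ = pseudoE ∧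
      tup4 q₂ a₂ p₂ e₂ = checksign sca₂ pkA ∧ q₃ = ques ∧ a₃ = ans ∧ p₃ = pseudoC ∧ e₃ = pseudoE ∧
      sca₃ = sca₂)
    (OK [pseudoC, ques, ans]) KO) KO) KO) KO) KO) KO) KO) KO

/-- The notification belongs to `Assigned` once the signature by the exam authority that it contains
is checked, and to `Marked` once its signature by the examiner is checked. -/
noncomputable def testMI (pkA pch bn ba : Msg) : Proc :=
  .inp pch fun x => .let4 x (fun privC ques ans pseudoC =>
  .inp bn fun y => .let4 y (fun pseudoE _he _role _spseE =>
  .inp ba fun ema =>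
  .let2 (decrypt ema privC) (fun ma sma => .let3 ma (fun ca₁ sca₁ mark => .let4 ca₁ (fun q₁ a₁ p₁ e₁ =>
  .cond (tup4 q₁ a₁ p₁ e₁ = checksign sca₁ pkA)
    (.event ⟨.assigned, [p₁, q₁, a₁, mark]⟩ <|
    .let3 (checksign sma pseudoE) (fun ca₂ _sca₂ mark' => .let4 ca₂ (fun q₂ a₂ p₂ e₂ =>
    .event ⟨.marked, [p₂, q₂, a₂, mark']⟩ <|
    .cond (q₁ = ques ∧ a₁ = ans ∧ p₁ = pseudoC ∧ e₁ = pseudoE ∧ q₂ = ques ∧ a₂ = ans ∧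
        p₂ = pseudoC ∧ e₂ = pseudoE ∧ mark = mark')
      (OK [pseudoC, ques, ans, mark]) KO) KO) KO)
    KO) KO) KO) KO) KO) KO

noncomputable def testMNI (pkA pch _bn ba : Msg) : Proc :=
  .inp pch fun x => .let4 x (fun privC mark pseudoC _ema' =>
  .inp ba fun ema =>
  .let2 (decrypt ema privC) (fun ma _sma => .let3 ma (fun ca sca mark' => .let4 ca (fun q a p e =>
  .cond (tup4 q a p e = checksign sca pkA)
    (.event ⟨.assigned, [p, mark']⟩ <|
    .cond (p = pseudoC ∧ mark' = mark) (OK [pseudoC, mark]) KO)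
    KO) KO) KO) KO) KO

/-- The six individual verifiability requirements: Question Validity, Marking Correctness, Test
Integrity, Test Markedness, Mark Integrity, Mark Notification Integrity. -/
inductive Requirement
  | QV | MC | TI | TM | MI | MNI

noncomputable def Requirement.test : Requirement → (pkA pch bn ba : Msg) → Proc
  | .QV => testQV
  | .MC => testMC
  | .TI => testTI
  | .TM => testTM
  | .MI => testMI
  | .MNI => testMNI

/-- What the candidate sends to the test on the private channel `pch`, as soon as she has it. -/
noncomputable def Requirement.report : Requirement → (pch : Msg) → Report
  | .QV, pch => { question := fun privC ques _ => .out pch (tup2 ques privC) .nil }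
  | .MC, pch => { notification := fun v => .out pch (tup3 v.ques v.ans v.mark) .nil }
  | .MNI, pch =>
    { notification := fun v => .out pch (tup4 v.privC v.mark v.pseudoC v.notif) .nil }
  | .TI, pch | .TM, pch | .MI, pch =>
    { submission := fun privC pseudoC ques ans => .out pch (tup4 privC ques ans pseudoC) .nil }

/-- What the candidate sends to the test on private channels in an honest run: her data on `pch`, and
the posts of the bulletin board that concern her on `bn` and `ba`. -/
noncomputable def Requirement.fullReport : Requirement → (pch bn ba : Msg) → Report
  | .QV, pch, _, ba =>
    { question := fun privC ques eques => .out ba eques <| .out pch (tup2 ques privC) .nil }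
  | .MC, pch, _, _ => { notification := fun v => .out pch (tup3 v.ques v.ans v.mark) .nil }
  | .TI, pch, bn, ba =>
    { notification := fun v =>
        .out pch (tup4 v.privC v.ques v.ans v.pseudoC) <|
        .out bn (tup4 v.pseudoE v.he v.role v.spseE) <|
        .out ba v.receipt <| .out ba v.notif .nil }
  | .TM, pch, bn, ba | .MI, pch, bn, ba =>
    { notification := fun v =>
        .out pch (tup4 v.privC v.ques v.ans v.pseudoC) <|
        .out bn (tup4 v.pseudoE v.he v.role v.spseE) <| .out ba v.notif .nil }
  | .MNI, pch, _, ba =>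
    { notification := fun v =>
        .out pch (tup4 v.privC v.mark v.pseudoC v.notif) <| .out ba v.notif .nil }

/-- The process in which soundness is examined: every honest candidate runs the test, which reads the
posts of the bulletin board from the public channels. -/
noncomputable def soundnessProc (R : Requirement) (κ : Corruption) (ρ : Marking) : Proc :=
  exam κ ρ fun skC pkA pkN ans =>
    .new fun pch => .par (Cand (R.report pch) skC pkA pkN ans) (R.test pkA pch bbn bba)

/-- The process in which completeness is examined: all principals are honest and the test reads all
its data from private channels. -/
noncomputable def completenessProc (R : Requirement) (ρ : Marking) : Proc :=
  exam Corruption.none ρ fun skC pkA pkN ans =>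
    .new fun pch => .new fun bn => .new fun ba =>
      .par (Cand (R.fullReport pch bn ba) skC pkA pkN ans) (R.test pkA pch bn ba)

/-- Completeness: honest runs never execute `KO`, and some honest run executes `OK`. -/
def Complete (R : Requirement) (ρ : Marking) : Prop :=
  ¬ Executes (completenessProc R ρ) .KO ∧ Executes (completenessProc R ρ) .OK

end Remark

open Remark

/-! Two arguments are combined: an invariant of all runs gives soundness and the absence of `KO`,
and explicit runs give the reachability of `OK`.

The invariant is a type system, `Safe`. Each name receives a kind when it is generated: public,
channel between a candidate and her test, or signing key of an honest authority, mixnet or examiner.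
A message is `Good` if private names are not exposed: restricted keys occur only inside public keys
and in signatures on messages that the owner is willing to sign (`Auth`). Secrecy of plaintexts
plays no role, since the content of a good ciphertext must be good and candidates' keys count as
public; only the unforgeability of signatures and the private channels matter. The equational theory
has unique normal forms (`Term.Eqv.nf_eq`), so goodness is read off the normal form, and a
successful check that returns a tuple can be inverted into an equation for the signature. The
attacker cannot derive a message that is not good (`Derives.good`), steps preserve the invariant
(`Inv.step`), and hence every event of a well-typed process satisfies the condition imposed on it
(`Safe.ev_of_reaches`). Private channels are typed with linear tokens: a session has at most one
sender and one receiver, who agree on the history, so that the receiver may assume what the sender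
has guaranteed.

Soundness. Four tests execute the required events themselves, and their final comparison identifies
the arguments with those of `OK`. For Question Validity, the restricted key of the authority signs a
pair only if its first component was generated. For Marking Correctness, the candidate reports a
mark only after accepting it, and the table contains correct marks only.

No `KO`. The candidate passes on posts that she has already checked, and the test repeats her
checks. Marking Correctness needs more: the mixnet certifies examiners' pseudonyms only for honest
keys, whose owners sign only correct marks (`mark_eq_of_checksign`).

Reachability of `OK`. The attacker relays all posts (`can_principals`), and the candidate then
serves the test (`can_test`). -/

namespace Remark
open Msg

/-! ### Normal forms -/

/-- Reduction at the root of a term. -/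
inductive Term.Head : Term → Term → Prop
  | decrypt_pk (m k r) : Head (decrypt (encrypt m (pk k) r) k) m
  | decrypt_pseudo (m k e r) :
      Head (decrypt (encrypt m (pseudoPub (pk k) e) r) (pseudoPriv k (exp e))) m
  | check_pseudo (k e) :
      Head (checkPseudo (pseudoPub (pk k) e) (pseudoPriv k (exp e))) (const .tt)
  | getmess_sign (m k) : Head (getmess (sign m k)) m
  | checksign_pk (m k) : Head (checksign (sign m k) (pk k)) m
  | checksign_pseudo (m k e) :
      Head (checksign (sign m (pseudoPriv k (exp e))) (pseudoPub (pk k) e)) m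

/-- The rules do not overlap: two rules for the same destructor differ in whether the public key is
a `pk` or a `pseudoPub`. -/
theorem Term.Head.unique {t u v : Term} (h : Head t u) (h' : Head t v) : u = v := by
  cases h <;> cases h' <;> rfl

theorem Term.Head.eqv {t u : Term} (h : Head t u) : Eqv t u := by
  cases h
  exacts [.decrypt_pk _ _ _, .decrypt_pseudo _ _ _ _, .check_pseudo _ _, .getmess_sign _ _,
    .checksign_pk _ _, .checksign_pseudo _ _ _]

open Classical in
/-- One reduction at the root, if possible. -/
noncomputable def Term.red (t : Term) : Term := if h : ∃ u, Head t u then h.choose else t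

theorem Term.Head.red_eq {t u : Term} (h : Head t u) : t.red = u := by
  have h' : ∃ u, Head t u := ⟨u, h⟩
  rw [Term.red, dif_pos h']
  exact h'.choose_spec.unique h

theorem Term.red_cases (t : Term) : Head t t.red ∨ t.red = t := by
  by_cases h : ∃ u, Head t u
  · left; rw [Term.red, dif_pos h]; exact h.choose_spec
  · right; rw [Term.red, dif_neg h]

/-- The normal form of a term. -/
noncomputable def Term.nf : Term → Term
  | name n => name n
  | att n => att n
  | const c => const c
  | pk k => pk k.nf
  | exp r => exp r.nf
  | encrypt m k r => encrypt m.nf k.nf r.nf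
  | decrypt c k => (decrypt c.nf k.nf).red
  | sign m k => sign m.nf k.nf
  | getmess s => (getmess s.nf).red
  | checksign s k => (checksign s.nf k.nf).red
  | pseudoPub k r => pseudoPub k.nf r.nf
  | pseudoPriv k h => pseudoPriv k.nf h.nf
  | checkPseudo p k => (checkPseudo p.nf k.nf).red
  | correct q a => correct q.nf a.nf
  | tup2 a b => tup2 a.nf b.nf
  | tup3 a b c => tup3 a.nf b.nf c.nf
  | tup4 a b c d => tup4 a.nf b.nf c.nf d.nf

theorem Term.eqv_red (t : Term) : Eqv t t.red := by
  rcases t.red_cases with h | h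
  · exact h.eqv
  · rw [h]; exact .refl t

theorem Term.eqv_nf (t : Term) : Eqv t t.nf := by
  induction t with
  | name | att | const => exact .refl _
  | pk _ h => exact .cpk h
  | exp _ h => exact .cexp h
  | encrypt _ _ _ h₁ h₂ h₃ => exact .cencrypt h₁ h₂ h₃
  | decrypt _ _ h₁ h₂ => exact (Eqv.cdecrypt h₁ h₂).trans (eqv_red _)
  | sign _ _ h₁ h₂ => exact .csign h₁ h₂
  | getmess _ h => exact (Eqv.cgetmess h).trans (eqv_red _)
  | checksign _ _ h₁ h₂ => exact (Eqv.cchecksign h₁ h₂).trans (eqv_red _)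
  | pseudoPub _ _ h₁ h₂ => exact .cpseudoPub h₁ h₂
  | pseudoPriv _ _ h₁ h₂ => exact .cpseudoPriv h₁ h₂
  | checkPseudo _ _ h₁ h₂ => exact (Eqv.ccheckPseudo h₁ h₂).trans (eqv_red _)
  | correct _ _ h₁ h₂ => exact .ccorrect h₁ h₂
  | tup2 _ _ h₁ h₂ => exact .ctup2 h₁ h₂
  | tup3 _ _ _ h₁ h₂ h₃ => exact .ctup3 h₁ h₂ h₃
  | tup4 _ _ _ _ h₁ h₂ h₃ h₄ => exact .ctup4 h₁ h₂ h₃ h₄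

/-- Each left-hand side is one destructor over constructors, and each right-hand side is one of its
variables or a constant. Once the arguments are normalized, a single root step therefore gives the
normal form of the right-hand side. -/
theorem Term.Eqv.nf_eq {t u : Term} (h : Eqv t u) : t.nf = u.nf := by
  induction h with
  | refl => rfl
  | symm _ ih => exact ih.symm
  | trans _ _ ih₁ ih₂ => exact ih₁.trans ih₂
  | decrypt_pk => exact (Head.decrypt_pk _ _ _).red_eq
  | decrypt_pseudo => exact (Head.decrypt_pseudo _ _ _ _).red_eq
  | check_pseudo => exact (Head.check_pseudo _ _).red_eq
  | getmess_sign => exact (Head.getmess_sign _ _).red_eq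
  | checksign_pk => exact (Head.checksign_pk _ _).red_eq
  | checksign_pseudo => exact (Head.checksign_pseudo _ _ _).red_eq
  | _ => simp only [Term.nf, *]

/-! ### Normal forms of messages and inversion of successful checks. -/

namespace Msg

/-- The normal form of a message. -/
noncomputable def nf : Msg → Term := Quotient.lift Term.nf fun _ _ h => Term.Eqv.nf_eq h

theorem mk_nf (m : Msg) : mk m.nf = m := by
  induction m using Quotient.inductionOn with
  | h t => exact Quotient.sound (t.eqv_nf.symm)

theorem nf_injective : Function.Injective nf := fun a b h => by rw [← mk_nf a, ← mk_nf b, h]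

theorem nf_inj {a b : Msg} : a.nf = b.nf ↔ a = b := nf_injective.eq_iff

@[simp] theorem nf_name (n : ℕ) : (name n).nf = .name n := rfl
@[simp] theorem nf_att (n : ℕ) : (att n).nf = .att n := rfl
@[simp] theorem nf_const (c : Const) : (const c).nf = .const c := rfl
@[simp] theorem nf_pk (k : Msg) : (pk k).nf = .pk k.nf := by
  induction k using Quotient.inductionOn; rfl
@[simp] theorem nf_exp (r : Msg) : (exp r).nf = .exp r.nf := by
  induction r using Quotient.inductionOn; rfl
@[simp] theorem nf_getmess (s : Msg) : (getmess s).nf = (Term.getmess s.nf).red := by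
  induction s using Quotient.inductionOn; rfl
@[simp] theorem nf_decrypt (c k : Msg) : (decrypt c k).nf = (Term.decrypt c.nf k.nf).red := by
  induction c, k using Quotient.inductionOn₂; rfl
@[simp] theorem nf_sign (m k : Msg) : (sign m k).nf = .sign m.nf k.nf := by
  induction m, k using Quotient.inductionOn₂; rfl
@[simp] theorem nf_checksign (s k : Msg) :
    (checksign s k).nf = (Term.checksign s.nf k.nf).red := by
  induction s, k using Quotient.inductionOn₂; rfl
@[simp] theorem nf_pseudoPub (k r : Msg) : (pseudoPub k r).nf = .pseudoPub k.nf r.nf := by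
  induction k, r using Quotient.inductionOn₂; rfl
@[simp] theorem nf_pseudoPriv (k h : Msg) : (pseudoPriv k h).nf = .pseudoPriv k.nf h.nf := by
  induction k, h using Quotient.inductionOn₂; rfl
@[simp] theorem nf_checkPseudo (p k : Msg) :
    (checkPseudo p k).nf = (Term.checkPseudo p.nf k.nf).red := by
  induction p, k using Quotient.inductionOn₂; rfl
@[simp] theorem nf_correct (q a : Msg) : (correct q a).nf = .correct q.nf a.nf := by
  induction q, a using Quotient.inductionOn₂; rfl
@[simp] theorem nf_tup2 (a b : Msg) : (tup2 a b).nf = .tup2 a.nf b.nf := by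
  induction a, b using Quotient.inductionOn₂; rfl
@[simp] theorem nf_tup3 (a b c : Msg) : (tup3 a b c).nf = .tup3 a.nf b.nf c.nf := by
  -- This symbol is defined through chosen representatives, so the arguments are first written as
  -- classes of terms.
  rw [← mk_nf a, ← mk_nf b, ← mk_nf c, tup3_mk]; rfl
@[simp] theorem nf_tup4 (a b c d : Msg) : (tup4 a b c d).nf = .tup4 a.nf b.nf c.nf d.nf := by
  rw [← mk_nf a, ← mk_nf b, ← mk_nf c, ← mk_nf d, tup4_mk]; rfl
@[simp] theorem nf_encrypt (m k r : Msg) : (encrypt m k r).nf = .encrypt m.nf k.nf r.nf := by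
  rw [← mk_nf m, ← mk_nf k, ← mk_nf r, encrypt_mk]; rfl

@[simp] theorem tup2_inj {a b a' b' : Msg} : tup2 a b = tup2 a' b' ↔ a = a' ∧ b = b' := by
  simp [← nf_inj]
@[simp] theorem tup3_inj {a b c a' b' c' : Msg} :
    tup3 a b c = tup3 a' b' c' ↔ a = a' ∧ b = b' ∧ c = c' := by simp [← nf_inj]
@[simp] theorem tup4_inj {a b c d a' b' c' d' : Msg} :
    tup4 a b c d = tup4 a' b' c' d' ↔ a = a' ∧ b = b' ∧ c = c' ∧ d = d' := by simp [← nf_inj]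
@[simp] theorem name_inj {n n' : ℕ} : name n = name n' ↔ n = n' := by simp [← nf_inj]

@[simp] theorem decrypt_encrypt (m k r : Msg) : decrypt (encrypt m (pk k) r) k = m := by
  rw [← nf_inj]; simpa using (Term.Head.decrypt_pk _ _ _).red_eq
@[simp] theorem decrypt_encrypt_pseudo (m k e r : Msg) :
    decrypt (encrypt m (pseudoPub (pk k) e) r) (pseudoPriv k (exp e)) = m := by
  rw [← nf_inj]; simpa using (Term.Head.decrypt_pseudo _ _ _ _).red_eq
@[simp] theorem checkPseudo_pseudo (k e : Msg) :
    checkPseudo (pseudoPub (pk k) e) (pseudoPriv k (exp e)) = const .tt := by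
  rw [← nf_inj]; simpa using (Term.Head.check_pseudo _ _).red_eq
@[simp] theorem checksign_sign (m k : Msg) : checksign (sign m k) (pk k) = m := by
  rw [← nf_inj]; simpa using (Term.Head.checksign_pk _ _).red_eq
@[simp] theorem checksign_sign_pseudo (m k e : Msg) :
    checksign (sign m (pseudoPriv k (exp e))) (pseudoPub (pk k) e) = m := by
  rw [← nf_inj]; simpa using (Term.Head.checksign_pseudo _ _ _).red_eq

/-- Messages built by a constructor of tuples. -/
def IsTuple (m : Msg) : Prop :=
  (∃ a b, m = tup2 a b) ∨ (∃ a b c, m = tup3 a b c) ∨ ∃ a b c d, m = tup4 a b c d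

theorem isTuple_tup2 (a b : Msg) : IsTuple (tup2 a b) := .inl ⟨a, b, rfl⟩
theorem isTuple_tup3 (a b c : Msg) : IsTuple (tup3 a b c) := .inr (.inl ⟨a, b, c, rfl⟩)

/-- An irreducible destructor is not a tuple, so a destructor whose value is a tuple must have been
reduced at the root. -/
theorem IsTuple.head {m : Msg} (hm : IsTuple m) {t : Term} (h : m.nf = t.red)
    (ht : (∃ c k, t = .decrypt c k) ∨ ∃ s k, t = .checksign s k) : t.Head m.nf := by
  rcases t.red_cases with h' | h'
  · rwa [h]
  · exfalso
    rw [h'] at h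
    rcases hm with ⟨a, b, rfl⟩ | ⟨a, b, c, rfl⟩ | ⟨a, b, c, d, rfl⟩ <;>
      rcases ht with ⟨_, _, rfl⟩ | ⟨_, _, rfl⟩ <;> simp at h

theorem IsTuple.decrypt_head {m c k : Msg} (hm : IsTuple m) (h : decrypt c k = m) :
    (Term.decrypt c.nf k.nf).Head m.nf :=
  hm.head (by rw [← h, nf_decrypt]) (.inl ⟨_, _, rfl⟩)

theorem IsTuple.checksign_head {m s k : Msg} (hm : IsTuple m) (h : checksign s k = m) :
    (Term.checksign s.nf k.nf).Head m.nf :=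
  hm.head (by rw [← h, nf_checksign]) (.inr ⟨_, _, rfl⟩)

/-- Only one rule verifies against a key of the form `pk k`. A check made by a principal thus
becomes an equation for the message that he received. -/
theorem IsTuple.checksign_pk {m s k : Msg} (hm : IsTuple m) (h : checksign s (pk k) = m) :
    s = sign m k := by
  have h' := hm.checksign_head h
  rw [← nf_inj, nf_sign]
  rw [nf_pk] at h'
  generalize s.nf = s' at *
  cases h'; rfl

theorem IsTuple.checksign_pseudoPub {m s k e : Msg} (hm : IsTuple m)
    (h : checksign s (pseudoPub (pk k) e) = m) : s = sign m (pseudoPriv k (exp e)) := by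
  have h' := hm.checksign_head h
  rw [← nf_inj, nf_sign, nf_pseudoPriv, nf_exp]
  rw [nf_pseudoPub, nf_pk] at h'
  generalize s.nf = s' at *
  cases h'; rfl

end Msg

/-! ### Typing of names and processes -/

/-- Owners of a restricted signing key. -/
inductive KeyType
  | ea | net | ex

/-- The three channels between a candidate and her test. -/
inductive Chan
  | pch | bn | ba

/-- The messages exchanged in a session between a candidate and her test, latest first. -/
abbrev Hist := List (Chan × Msg)

/-- The use of a name: a name that may become public, a channel of the session `p`, or a key that
is only used for signing and for receiving. -/
inductive Kind
  | pub
  | chan (p : ℕ) (c : Chan)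
  | key (ty : KeyType)

/-- The right to send (or to receive) the next message in the session `sess`. -/
structure Tok where
  recv : Bool
  sess : ℕ
  hist : Hist

/-- What is fixed when the invariants of the exam are examined: the setting, the condition under
which an event may be executed after a given log, and the condition on the histories of sessions. -/
structure Setting where
  κ : Corruption
  ρ : Marking
  ev : List Event → Event → Prop
  sp : List Event → Hist → Prop
  sp_mono : ∀ {L L' h}, L <:+ L' → sp L h → sp L' h

/-- The kinds of the names generated so far, and the log. -/
structure World where
  kind : ℕ → Option Kind
  log : List Event

/-- The order is the passage of time: kinds are never revised, and the log, latest event first,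
grows at its head, so an earlier log is a suffix. -/
instance : Preorder World where
  le w w' := (∀ n k, w.kind n = some k → w'.kind n = some k) ∧ w.log <:+ w'.log
  le_refl w := ⟨fun _ _ h => h, List.suffix_rfl⟩
  le_trans _ _ _ h h' := ⟨fun n k e => h'.1 n k (h.1 n k e), h.2.trans h'.2⟩

theorem World.kind_mono {w w' : World} (h : w ≤ w') {n : ℕ} {k : Kind} (e : w.kind n = some k) :
    w'.kind n = some k := h.1 n k e

theorem World.log_mono {w w' : World} (h : w ≤ w') {e : Event} (he : e ∈ w.log) : e ∈ w'.log :=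
  h.2.subset he

def World.push (w : World) (e : Event) : World := ⟨w.kind, e :: w.log⟩

def World.alloc (w : World) (n : ℕ) (k : Kind) : World := ⟨Function.update w.kind n (some k), w.log⟩

theorem World.le_push (w : World) (e : Event) : w ≤ w.push e :=
  ⟨fun _ _ h => h, List.suffix_cons _ _⟩

theorem World.le_alloc {w : World} {n : ℕ} (h : w.kind n = none) (k : Kind) : w ≤ w.alloc n k := by
  refine ⟨fun m k' e => ?_, List.suffix_rfl⟩
  have : m ≠ n := by rintro rfl; simp [h] at e
  simpa [World.alloc, this] using e

theorem World.alloc_self (w : World) (n : ℕ) (k : Kind) : (w.alloc n k).kind n = some k := by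
  simp [World.alloc]

variable (σ : Setting)

/-- The messages that the owner of a restricted key signs. -/
def Auth (w : World) : KeyType → Term → Prop
  | .ea, m => ∀ q p, m = .tup2 q p → ⟨.generated, [mk q]⟩ ∈ w.log
  | .net, m => σ.κ.examiners = false → ∀ p h, m = .tup3 p h (.const .roleE) →
      ∃ e x, p = .pseudoPub (.pk (.name e)) x ∧ w.kind e = some (.key .ex)
  | .ex, m => σ.ρ = .correct → ∀ q a i e s k, m = .tup3 (.tup4 q a i e) s k → k = .correct q a

/-- The terms that may become public: names of channels do not occur, and restricted keys occur only
in public keys and in authorized signatures. -/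
def Term.Good (w : World) : Term → Prop
  | name n => w.kind n = some .pub
  | att _ => True
  | const _ => True
  | pk k => k.Good w ∨ ∃ n ty, k = name n ∧ w.kind n = some (.key ty)
  | exp r => r.Good w
  | encrypt m k r => m.Good w ∧ k.Good w ∧ r.Good w
  | decrypt c k => c.Good w ∧ k.Good w
  | sign m k => m.Good w ∧ (k.Good w ∨ ∃ n ty, (k = name n ∨ ∃ h, k = pseudoPriv (name n) h) ∧
      w.kind n = some (.key ty) ∧ Auth σ w ty m)
  | getmess s => s.Good w
  | checksign s k => s.Good w ∧ k.Good w
  | pseudoPub k r => k.Good w ∧ r.Good w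
  | pseudoPriv k h => k.Good w ∧ h.Good w
  | checkPseudo p k => p.Good w ∧ k.Good w
  | correct q a => q.Good w ∧ a.Good w
  | tup2 a b => a.Good w ∧ b.Good w
  | tup3 a b c => a.Good w ∧ b.Good w ∧ c.Good w
  | tup4 a b c d => a.Good w ∧ b.Good w ∧ c.Good w ∧ d.Good w

variable {σ}

theorem Auth.mono {w w' : World} (h : w ≤ w') {ty : KeyType} {m : Term} (hm : Auth σ w ty m) :
    Auth σ w' ty m := by
  cases ty with
  | ea => exact fun q p e => World.log_mono h (hm q p e)
  | net =>
    intro hκ p x e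
    obtain ⟨n, y, h₁, h₂⟩ := hm hκ p x e
    exact ⟨n, y, h₁, World.kind_mono h h₂⟩
  | ex => exact hm

/-- Kinds of names and logged events are only required to be present, and later worlds keep them. -/
theorem Term.Good.mono {w w' : World} (h : w ≤ w') {t : Term} (ht : t.Good σ w) :
    t.Good σ w' := by
  induction t with
  | name n => exact World.kind_mono h ht
  | att | const => trivial
  | exp _ ih => exact ih ht
  | getmess _ ih => exact ih ht
  | pk k ih => exact ht.imp ih fun ⟨n, ty, e, hn⟩ => ⟨n, ty, e, World.kind_mono h hn⟩
  | sign m k ih₁ ih₂ =>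
    exact ⟨ih₁ ht.1, ht.2.imp ih₂ fun ⟨n, ty, e, hn, ha⟩ =>
      ⟨n, ty, e, World.kind_mono h hn, ha.mono h⟩⟩
  | encrypt _ _ _ ih₁ ih₂ ih₃ => exact ⟨ih₁ ht.1, ih₂ ht.2.1, ih₃ ht.2.2⟩
  | tup3 _ _ _ ih₁ ih₂ ih₃ => exact ⟨ih₁ ht.1, ih₂ ht.2.1, ih₃ ht.2.2⟩
  | tup4 _ _ _ _ ih₁ ih₂ ih₃ ih₄ => exact ⟨ih₁ ht.1, ih₂ ht.2.1, ih₃ ht.2.2.1, ih₄ ht.2.2.2⟩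
  | _ _ _ ih₁ ih₂ => exact ⟨ih₁ ht.1, ih₂ ht.2⟩

/-- A rule returns a constant or a plaintext or signed message whose goodness was already required;
it never returns a key. -/
theorem Term.Head.good {w : World} {t u : Term} (h : Head t u) (ht : t.Good σ w) : u.Good σ w := by
  cases h <;> simp only [Term.Good] at ht ⊢ <;> tauto

theorem Term.Good.red {w : World} {t : Term} (ht : t.Good σ w) : t.red.Good σ w := by
  rcases t.red_cases with h | h
  · exact h.good ht
  · rwa [h]

variable (σ) in
/-- Messages that may become public. -/
def Msg.Good (w : World) (m : Msg) : Prop := m.nf.Good σ w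

/-! ### Goodness of messages and unforgeability of signatures. -/

namespace Msg
variable {w w' : World}

theorem Good.mono (h : w ≤ w') {m : Msg} (hm : m.Good σ w) : m.Good σ w' := Term.Good.mono h hm

@[simp] theorem good_name {n : ℕ} : (name n).Good σ w ↔ w.kind n = some .pub := by
  simp [Good, Term.Good]
@[simp] theorem good_att {n : ℕ} : (att n).Good σ w := by simp [Good, Term.Good]
@[simp] theorem good_const {c : Const} : (const c).Good σ w := by simp [Good, Term.Good]
theorem Good.pk {k : Msg} (h : k.Good σ w) : (pk k).Good σ w := by
  simpa [Good, Term.Good] using .inl h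
theorem good_pk_key {n : ℕ} {ty : KeyType} (h : w.kind n = some (.key ty)) :
    (Msg.pk (name n)).Good σ w := by
  simpa [Good, Term.Good] using .inr ⟨ty, h⟩
@[simp] theorem good_exp {r : Msg} : (exp r).Good σ w ↔ r.Good σ w := by simp [Good, Term.Good]
@[simp] theorem good_encrypt {m k r : Msg} :
    (encrypt m k r).Good σ w ↔ m.Good σ w ∧ k.Good σ w ∧ r.Good σ w := by simp [Good, Term.Good]
@[simp] theorem good_pseudoPub {k r : Msg} :
    (pseudoPub k r).Good σ w ↔ k.Good σ w ∧ r.Good σ w := by simp [Good, Term.Good]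
@[simp] theorem good_pseudoPriv {k h : Msg} :
    (pseudoPriv k h).Good σ w ↔ k.Good σ w ∧ h.Good σ w := by simp [Good, Term.Good]
@[simp] theorem good_correct {q a : Msg} :
    (correct q a).Good σ w ↔ q.Good σ w ∧ a.Good σ w := by simp [Good, Term.Good]
@[simp] theorem good_tup2 {a b : Msg} :
    (tup2 a b).Good σ w ↔ a.Good σ w ∧ b.Good σ w := by simp [Good, Term.Good]
@[simp] theorem good_tup3 {a b c : Msg} :
    (tup3 a b c).Good σ w ↔ a.Good σ w ∧ b.Good σ w ∧ c.Good σ w := by simp [Good, Term.Good]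
@[simp] theorem good_tup4 {a b c d : Msg} :
    (tup4 a b c d).Good σ w ↔ a.Good σ w ∧ b.Good σ w ∧ c.Good σ w ∧ d.Good σ w := by
  simp [Good, Term.Good]
theorem Good.sign {m k : Msg} (h : m.Good σ w) (hk : k.Good σ w) : (sign m k).Good σ w := by
  simpa [Good, Term.Good] using ⟨h, .inl hk⟩
theorem good_sign_key {m : Msg} {n : ℕ} {ty : KeyType} (h : m.Good σ w)
    (hn : w.kind n = some (.key ty)) (ha : Auth σ w ty m.nf) :
    (Msg.sign m (name n)).Good σ w := by
  unfold Good
  rw [nf_sign, nf_name]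
  exact ⟨h, .inr ⟨n, ty, .inl rfl, hn, ha⟩⟩
theorem good_sign_pseudo {m x : Msg} {n : ℕ} {ty : KeyType} (h : m.Good σ w)
    (hn : w.kind n = some (.key ty)) (ha : Auth σ w ty m.nf) :
    (Msg.sign m (pseudoPriv (name n) x)).Good σ w := by
  unfold Good
  rw [nf_sign, nf_pseudoPriv, nf_name]
  exact ⟨h, .inr ⟨n, ty, .inr ⟨_, rfl⟩, hn, ha⟩⟩
-- Unforgeability: a name of kind `key` is not good itself, so the signature can be good only
-- through the clause that requires authorization.
theorem auth_of_good_sign {m : Msg} {n : ℕ} {ty : KeyType} (h : (Msg.sign m (name n)).Good σ w)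
    (hn : w.kind n = some (.key ty)) : Auth σ w ty m.nf := by
  unfold Good at h
  rw [nf_sign, nf_name] at h
  rcases h.2 with h' | ⟨n', ty', h₁ | ⟨x, h₁⟩, h₂, h₃⟩
  · simp [Term.Good, hn] at h'
  · cases h₁; rw [hn] at h₂; cases h₂; exact h₃
  · cases h₁
theorem auth_of_good_sign_pseudo {m x : Msg} {n : ℕ} {ty : KeyType}
    (h : (Msg.sign m (pseudoPriv (name n) x)).Good σ w)
    (hn : w.kind n = some (.key ty)) : Auth σ w ty m.nf := by
  unfold Good at h
  rw [nf_sign, nf_pseudoPriv, nf_name] at h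
  rcases h.2 with h' | ⟨n', ty', h₁ | ⟨x, h₁⟩, h₂, h₃⟩
  · simp [Term.Good, hn] at h'
  · cases h₁
  · cases h₁; rw [hn] at h₂; cases h₂; exact h₃

/-- The plaintext is a component of the ciphertext, hence good whatever the key. Principals may thus
decrypt with restricted keys, and tests with keys about which nothing is known. -/
theorem Good.of_decrypt {c k m : Msg} (hc : c.Good σ w) (hm : IsTuple m) (h : Msg.decrypt c k = m) :
    m.Good σ w := by
  have h' := hm.decrypt_head h
  unfold Good at *
  generalize c.nf = c' at *
  generalize k.nf = k' at *
  generalize m.nf = m' at *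
  cases h' <;> exact hc.1

end Msg

/-- Goodness is closed under all symbols, under root reduction and under projections, so the
attacker never leaves the good messages. -/
theorem Derives.good {w : World} {K : Set Msg} (hK : ∀ m ∈ K, m.Good σ w) {m : Msg}
    (h : Derives K m) : m.Good σ w := by
  induction h with
  | known h => exact hK _ h
  | att | const => simp
  | pk _ ih => exact ih.pk
  | sign _ _ ih₁ ih₂ => exact ih₁.sign ih₂
  | decrypt _ _ ih₁ ih₂ =>
    unfold Msg.Good at *; rw [nf_decrypt]; exact Term.Good.red ⟨ih₁, ih₂⟩
  | checksign _ _ ih₁ ih₂ =>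
    unfold Msg.Good at *; rw [nf_checksign]; exact Term.Good.red ⟨ih₁, ih₂⟩
  | checkPseudo _ _ ih₁ ih₂ =>
    unfold Msg.Good at *; rw [nf_checkPseudo]; exact Term.Good.red ⟨ih₁, ih₂⟩
  | getmess _ ih =>
    unfold Msg.Good at *; rw [nf_getmess]; exact Term.Good.red (t := .getmess _) ih
  | _ => simp_all

variable (σ) in
/-- The entries of the tables. -/
def TabOK (w : World) : Table → Msg → Msg → Msg → Prop
  | .publickey, R, x, k => R.Good σ w ∧ x.Good σ w ∧ k.Good σ w ∧
      (σ.κ.examiners = false → R = roleE → ∃ e, k = pk (name e) ∧ w.kind e = some (.key .ex))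
  | .correctAns, q, a, m => m = correct q a

theorem TabOK.mono {w w' : World} (h : w ≤ w') {t : Table} {a b c : Msg} (ht : TabOK σ w t a b c) :
    TabOK σ w' t a b c := by
  cases t with
  | publickey =>
    obtain ⟨h₁, h₂, h₃, h₄⟩ := ht
    refine ⟨h₁.mono h, h₂.mono h, h₃.mono h, fun hκ hR => ?_⟩
    obtain ⟨e, he, hk⟩ := h₄ hκ hR
    exact ⟨e, he, World.kind_mono h hk⟩
  | correctAns => exact ht

/-- The tokens that come with a new name: both rights, if the name identifies a session. -/
def Kind.toks (n : ℕ) (h : Hist) : Kind → Multiset Tok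
  | .chan p .pch => if p = n then {⟨false, n, h⟩, ⟨true, n, h⟩} else 0
  | _ => 0

variable (σ) in
/-- `Safe P w r`: the process `P` with the tokens `r` respects the typing, from the world `w` on. -/
def Safe : Proc → World → Multiset Tok → Prop
  | .nil, _, _ => True
  | .par P Q, w, r => ∃ r₁ r₂, r₁ + r₂ ≤ r ∧ Safe P w r₁ ∧ Safe Q w r₂
  | .repl P, w, _ => Safe P w 0
  | .new P, w, r => ∀ w' ≥ w, ∀ n, w'.kind n = none →
      ∃ k h, Safe (P (name n)) (w'.alloc n k) (r + k.toks n h)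
  | .inp c P, w, r =>
      (c.Good σ w ∧ ∀ w' ≥ w, ∀ m, m.Good σ w' → Safe (P m) w' r) ∨
      ∃ n p x h, c = name n ∧ w.kind n = some (.chan p x) ∧ r = {⟨true, p, h⟩} ∧
        ∀ w' ≥ w, ∀ m, σ.sp w'.log ((x, m) :: h) → Safe (P m) w' {⟨true, p, (x, m) :: h⟩}
  | .out c m P, w, r =>
      (c.Good σ w ∧ m.Good σ w ∧ Safe P w r) ∨
      ∃ n p x h, c = name n ∧ w.kind n = some (.chan p x) ∧ r = {⟨false, p, h⟩} ∧
        σ.sp w.log ((x, m) :: h) ∧ Safe P w {⟨false, p, (x, m) :: h⟩}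
  | .cond φ P Q, w, r => (φ → Safe P w r) ∧ (¬ φ → Safe Q w r)
  | .let2 m P Q, w, r =>
      (∀ a b, m = tup2 a b → Safe (P a b) w r) ∧ ((∀ a b, m ≠ tup2 a b) → Safe Q w r)
  | .let3 m P Q, w, r =>
      (∀ a b c, m = tup3 a b c → Safe (P a b c) w r) ∧ ((∀ a b c, m ≠ tup3 a b c) → Safe Q w r)
  | .let4 m P Q, w, r =>
      (∀ a b c d, m = tup4 a b c d → Safe (P a b c d) w r) ∧
        ((∀ a b c d, m ≠ tup4 a b c d) → Safe Q w r)
  | .event e P, w, r => ∀ w' ≥ w, σ.ev w'.log e ∧ Safe P (w'.push e) r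
  | .insert t a b c P, w, r => TabOK σ w t a b c ∧ Safe P w r
  | .get t φ P, w, r => ∀ w' ≥ w, ∀ a b c, TabOK σ w' t a b c → φ a b c → Safe (P a b c) w' r

/-- Other processes extend the world while this one waits. Clauses that depend on the moment of
execution quantify over all later worlds; the remaining conditions are monotone, those on histories
by `sp_mono`. -/
theorem Safe.mono {P : Proc} {w w' : World} {r : Multiset Tok} (h : w ≤ w') (hP : Safe σ P w r) :
    Safe σ P w' r := by
  induction P generalizing w w' r with
  | nil => trivial
  | par P Q ih₁ ih₂ =>
    obtain ⟨r₁, r₂, hr, h₁, h₂⟩ := hP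
    exact ⟨r₁, r₂, hr, ih₁ h h₁, ih₂ h h₂⟩
  | repl P ih => exact ih h hP
  | new P ih => exact fun w'' hw => hP w'' (h.trans hw)
  | inp c P ih =>
    rcases hP with ⟨h₁, h₂⟩ | ⟨n, p, x, l, h₁, h₂, h₃, h₄⟩
    · exact .inl ⟨h₁.mono h, fun w'' hw => h₂ w'' (h.trans hw)⟩
    · exact .inr ⟨n, p, x, l, h₁, World.kind_mono h h₂, h₃, fun w'' hw => h₄ w'' (h.trans hw)⟩
  | out c m P ih =>
    rcases hP with ⟨h₁, h₂, h₃⟩ | ⟨n, p, x, l, h₁, h₂, h₃, h₄, h₅⟩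
    · exact .inl ⟨h₁.mono h, h₂.mono h, ih h h₃⟩
    · exact .inr ⟨n, p, x, l, h₁, World.kind_mono h h₂, h₃, σ.sp_mono h.2 h₄, ih h h₅⟩
  | cond φ P Q ih₁ ih₂ => exact ⟨fun hφ => ih₁ h (hP.1 hφ), fun hφ => ih₂ h (hP.2 hφ)⟩
  | let2 m P Q ih₁ ih₂ => exact ⟨fun a b e => ih₁ a b h (hP.1 a b e), fun e => ih₂ h (hP.2 e)⟩
  | let3 m P Q ih₁ ih₂ =>
    exact ⟨fun a b c e => ih₁ a b c h (hP.1 a b c e), fun e => ih₂ h (hP.2 e)⟩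
  | let4 m P Q ih₁ ih₂ =>
    exact ⟨fun a b c d e => ih₁ a b c d h (hP.1 a b c d e), fun e => ih₂ h (hP.2 e)⟩
  | event e P ih => exact fun w'' hw => hP w'' (h.trans hw)
  | insert t a b c P ih => exact ⟨hP.1.mono h, ih h hP.2⟩
  | get t φ P ih => exact fun w'' hw => hP w'' (h.trans hw)

/-- In every session, at most one sender and one receiver, who agree on the history. -/
def Valid (w : World) (r : Multiset Tok) : Prop :=
  (∀ t ∈ r, w.kind t.sess ≠ none) ∧
    ∀ p, ∃ h, r.filter (fun t => t.sess = p) ≤ {⟨false, p, h⟩, ⟨true, p, h⟩}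

theorem Valid.le {w : World} {r r' : Multiset Tok} (h : Valid w r) (hr : r' ≤ r) : Valid w r' :=
  ⟨fun t ht => h.1 t (Multiset.mem_of_le hr ht), fun p =>
    let ⟨l, hl⟩ := h.2 p; ⟨l, (Multiset.filter_le_filter _ hr).trans hl⟩⟩

theorem Valid.mono {w w' : World} {r : Multiset Tok} (hw : w ≤ w') (h : Valid w r) : Valid w' r :=
  ⟨fun t ht e => (by
    rcases hk : w.kind t.sess with _ | k
    · exact h.1 t ht hk
    · rw [World.kind_mono hw hk] at e; cases e), h.2⟩

/-- Tokens belong to names already generated, so a fresh name has none, and the pair created with it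
makes up its whole session. -/
theorem Valid.alloc {w : World} {r : Multiset Tok} {n : ℕ} (h : Valid w r) (hn : w.kind n = none)
    (k : Kind) (l : Hist) : Valid (w.alloc n k) (r + k.toks n l) := by
  have key : ∀ t ∈ k.toks n l, t.sess = n := by
    intro t ht
    unfold Kind.toks at ht
    split at ht
    · split_ifs at ht
      · simp at ht; rcases ht with rfl | rfl <;> rfl
      · simp at ht
    · simp at ht
  refine ⟨fun t ht => ?_, fun p => ?_⟩
  · rcases Multiset.mem_add.1 ht with ht | ht
    · exact (h.mono (World.le_alloc hn k)).1 t ht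
    · rw [key t ht, World.alloc_self]; simp
  · rw [Multiset.filter_add]
    by_cases hp : p = n
    · subst hp
      refine ⟨l, ?_⟩
      rw [Multiset.filter_eq_nil.2 (fun t ht e => h.1 t ht (by rw [e, hn])), zero_add]
      refine (Multiset.filter_le _ _).trans ?_
      unfold Kind.toks
      split
      · split_ifs
        · exact le_rfl
        · exact Multiset.zero_le _
      · exact Multiset.zero_le _
    · have hz : (k.toks n l).filter (fun t => t.sess = p) = 0 :=
        Multiset.filter_eq_nil.2 fun t ht e => hp (e.symm.trans (key t ht))
      rw [hz, add_zero]
      exact h.2 p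

/-- A session has at most two tokens, so the two at hand are all of them. Their histories agree and
may be exchanged for any other common history. -/
theorem Valid.comm {w : World} {p : ℕ} {l l' : Hist} {f : Multiset Tok}
    (h : Valid w ({⟨false, p, l⟩} + ({⟨true, p, l'⟩} + f))) :
    l = l' ∧ ∀ l₁, Valid w ({⟨false, p, l₁⟩} + ({⟨true, p, l₁⟩} + f)) := by
  obtain ⟨l₀, h₀⟩ := h.2 p
  simp only [Multiset.singleton_add, Multiset.filter_cons_of_pos] at h₀
  -- The two tokens exhaust the pair, so by cardinality the rest contains none of this session.
  have hf : f.filter (fun t => t.sess = p) = 0 := by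
    have := Multiset.card_le_card h₀
    simp at this
    exact Multiset.filter_eq_nil.2 this
  rw [hf] at h₀
  have e₁ := Multiset.mem_of_le h₀ (Multiset.mem_cons_self _ _)
  have e₂ := Multiset.mem_of_le h₀ (Multiset.mem_cons_of_mem (Multiset.mem_cons_self _ _))
  simp at e₁ e₂
  refine ⟨e₁.trans e₂.symm, fun l₁ => ⟨fun t ht => ?_, fun p' => ?_⟩⟩
  · simp only [Multiset.singleton_add, Multiset.mem_cons] at ht
    rcases ht with rfl | rfl | ht
    · exact h.1 ⟨false, p, l⟩ (by simp)
    · exact h.1 ⟨false, p, l⟩ (by simp)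
    · exact h.1 t (by simp [ht])
  · by_cases hp : p = p'
    · subst hp
      refine ⟨l₁, ?_⟩
      simp only [Multiset.singleton_add, Multiset.filter_cons_of_pos, hf]
      exact le_rfl
    · obtain ⟨l₂, h₂⟩ := h.2 p'
      refine ⟨l₂, le_trans (le_of_eq ?_) h₂⟩
      simp [hp]

/-- The invariant of configurations. -/
structure Inv (σ : Setting) (w : World) (M : Multiset (Multiset Tok × Proc)) (s : Config) :
    Prop where
  procs : M.map Prod.snd = s.procs
  safe : ∀ x ∈ M, Safe σ x.2 w x.1
  valid : Valid w (M.map Prod.fst).sum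
  fresh : ∀ n ≥ s.next, w.kind n = none
  log : w.log = s.log
  ev : ∀ l₁ e l₂, s.log = l₁ ++ e :: l₂ → σ.ev l₂ e
  tables : ∀ t a b c, (t, a, b, c) ∈ s.tables → TabOK σ w t a b c
  known : ∀ m ∈ s.known, m.Good σ w

/-! ### Preservation of the invariant. -/

section
variable {w w' : World} {M : Multiset (Multiset Tok × Proc)} {n : ℕ} {S : Multiset Proc}
  {T : Set (Table × Msg × Msg × Msg)} {K : Set Msg} {L : List Event} {P P' : Proc}
  {r r' : Multiset Tok}

theorem Inv.uncons (h : Inv σ w M ⟨n, P ::ₘ S, T, K, L⟩) :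
    ∃ r M', M = (r, P) ::ₘ M' ∧ Safe σ P w r ∧ M'.map Prod.snd = S := by
  classical
  obtain ⟨⟨r, P'⟩, hx, rfl, hS⟩ := (Multiset.map_eq_cons _ _ _ _).2 h.procs
  exact ⟨r, M.erase (r, P'), (Multiset.cons_erase hx).symm, h.safe _ hx, hS⟩

theorem Inv.replace (h : Inv σ w ((r, P) ::ₘ M) ⟨n, P ::ₘ S, T, K, L⟩)
    (hw : w ≤ w') (hP : Safe σ P' w' r') (hv : Valid w' (r' + (M.map Prod.fst).sum))
    (hf : ∀ m ≥ n, w'.kind m = none) (hL : w'.log = L) :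
    Inv σ w' ((r', P') ::ₘ M) ⟨n, P' ::ₘ S, T, K, L⟩ where
  procs := by
    have := h.procs
    simp only [Multiset.map_cons, Multiset.cons_inj_right] at this ⊢
    exact this
  safe x hx := by
    rcases Multiset.mem_cons.1 hx with rfl | hx
    · exact hP
    · exact (h.safe x (Multiset.mem_cons_of_mem hx)).mono hw
  valid := by simpa using hv
  fresh := hf
  log := hL
  ev := h.ev
  tables t a b c ht := (h.tables t a b c ht).mono hw
  known m hm := (h.known m hm).mono hw

theorem Inv.simple (h : Inv σ w ((r, P) ::ₘ M) ⟨n, P ::ₘ S, T, K, L⟩) (hP : Safe σ P' w r) :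
    Inv σ w ((r, P') ::ₘ M) ⟨n, P' ::ₘ S, T, K, L⟩ :=
  h.replace le_rfl hP (by simpa using h.valid) h.fresh h.log

/-- Covers termination, parallel composition and replication: the successors share the tokens of the
process, which may be lost but not duplicated. -/
theorem Inv.weaken (h : Inv σ w ((r, P) ::ₘ M) ⟨n, P ::ₘ S, T, K, L⟩)
    {N : Multiset (Multiset Tok × Proc)} (hN : ∀ x ∈ N, Safe σ x.2 w x.1)
    (hr : (N.map Prod.fst).sum ≤ r) :
    Inv σ w (N + M) ⟨n, N.map Prod.snd + S, T, K, L⟩ where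
  procs := by
    have := h.procs
    simp only [Multiset.map_cons, Multiset.cons_inj_right] at this
    simp [this]
  safe x hx := by
    rcases Multiset.mem_add.1 hx with hx | hx
    · exact hN x hx
    · exact h.safe x (Multiset.mem_cons_of_mem hx)
  valid := h.valid.le (by simpa using hr)
  fresh := h.fresh
  log := h.log
  ev := h.ev
  tables := h.tables
  known := h.known

end

/-- On public channels only good messages travel. The attacker takes no part in a session, because a
channel that he derives is good and the name of a session channel is not. Within a session the
histories of both ends agree, so the guarantee of the sender is the assumption of the receiver. -/
theorem Inv.step {w : World} {M : Multiset (Multiset Tok × Proc)} {s s' : Config}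
    (h : Inv σ w M s) (hs : Step s s') : ∃ w' M', Inv σ w' M' s' := by
  cases hs with
  | @nil n S T K L =>
    obtain ⟨r, M, rfl, hP, -⟩ := h.uncons
    exact ⟨w, 0 + M, by simpa using h.weaken (N := 0) (by simp) (by simp)⟩
  | @par n S T K L P Q =>
    obtain ⟨r, M, rfl, ⟨r₁, r₂, hr, h₁, h₂⟩, -⟩ := h.uncons
    suffices hN : ∀ x ∈ ({(r₁, P), (r₂, Q)} : Multiset (Multiset Tok × Proc)), Safe σ x.2 w x.1 from
      ⟨w, _, by simpa using h.weaken hN (by simpa using hr)⟩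
    rintro x hx
    simp at hx
    rcases hx with rfl | rfl
    exacts [h₁, h₂]
  | @repl n S T K L P =>
    obtain ⟨r, M, rfl, hP, -⟩ := h.uncons
    suffices hN : ∀ x ∈ ({(0, P), (r, .repl P)} : Multiset (Multiset Tok × Proc)),
        Safe σ x.2 w x.1 from ⟨w, _, by simpa using h.weaken hN (by simp)⟩
    rintro x hx
    simp at hx
    rcases hx with rfl | rfl <;> exact hP
  | @new n S T K L P =>
    obtain ⟨r, M, rfl, hP, hM⟩ := h.uncons
    have hn : w.kind n = none := h.fresh n le_rfl
    obtain ⟨k, l, hP⟩ := hP w le_rfl n hn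
    have hv : Valid (w.alloc n k) ((r + k.toks n l) + (M.map Prod.fst).sum) := by
      rw [add_right_comm]
      exact Valid.alloc (by simpa using h.valid) hn k l
    have hle := World.le_alloc hn k
    refine ⟨w.alloc n k, (_, P (name n)) ::ₘ M, by simpa using hM, ?_, by simpa using hv, ?_, h.log,
      h.ev, fun t a b c ht => (h.tables t a b c ht).mono hle, fun m hm => (h.known m hm).mono hle⟩
    · intro x hx
      rcases Multiset.mem_cons.1 hx with rfl | hx
      · exact hP
      · exact (h.safe x (Multiset.mem_cons_of_mem hx)).mono hle
    · intro m hm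
      have h₁ : n < m := hm
      have h₂ : m ≠ n := by omega
      simpa [World.alloc, h₂] using h.fresh m h₁.le
  | @comm n S T K L c m P Q =>
    obtain ⟨r, M₁, rfl, hP, hM⟩ := h.uncons
    classical
    obtain ⟨⟨r', Q'⟩, hx, rfl, hS⟩ := (Multiset.map_eq_cons _ _ _ _).2 hM
    have hQ := h.safe _ (Multiset.mem_cons_of_mem hx)
    obtain ⟨M, rfl⟩ := Multiset.exists_cons_of_mem hx
    simp only [Multiset.erase_cons_head] at hS
    -- Both ends type the channel alike: the name of a session channel is not good, which excludes
    -- the mixed cases.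
    have key : ∃ r₁ r₁', Safe σ P w r₁ ∧ Safe σ (Q m) w r₁' ∧
        Valid w (r₁ + (r₁' + (M.map Prod.fst).sum)) := by
      have hv : Valid w (r + (r' + (M.map Prod.fst).sum)) := by simpa using h.valid
      rcases hP with ⟨hc, hm, hP⟩ | ⟨k, p, x, l, rfl, hk, rfl, hsp, hP⟩
      · rcases hQ with ⟨-, hQ⟩ | ⟨k, p, x, l, rfl, hk, -⟩
        · exact ⟨r, r', hP, hQ w le_rfl m hm, hv⟩
        · simp [hk] at hc
      · rcases hQ with ⟨hc, hQ⟩ | ⟨k', p', x', l', hkk, hk', rfl, hQ⟩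
        · simp [hk] at hc
        · rw [name_inj] at hkk
          subst hkk
          rw [hk] at hk'
          cases hk'
          obtain ⟨rfl, hv'⟩ := hv.comm
          exact ⟨_, _, hP, hQ w le_rfl m hsp, hv' _⟩
    obtain ⟨r₁, r₁', hP', hQ', hv⟩ := key
    refine ⟨w, (r₁, P) ::ₘ (r₁', Q m) ::ₘ M, by simpa using hS, ?_, by simpa using hv, h.fresh,
      h.log, h.ev, h.tables, h.known⟩
    intro x hx
    simp only [Multiset.mem_cons] at hx
    rcases hx with rfl | rfl | hx
    exacts [hP', hQ', h.safe x (by simp [hx])]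
  | @recv n S T K L c m P hc =>
    obtain ⟨r, M, rfl, hP, -⟩ := h.uncons
    have hc := hc.good h.known
    rcases hP with ⟨-, hm, hP⟩ | ⟨k, p, x, l, rfl, hk, -⟩
    · refine ⟨w, _, { h.simple hP with known := ?_ }⟩
      rintro x (rfl | hx)
      exacts [hm, h.known x hx]
    · simp [hk] at hc
  | @send n S T K L c m P hc hm =>
    obtain ⟨r, M, rfl, hP, -⟩ := h.uncons
    have hc := hc.good h.known
    rcases hP with ⟨-, hP⟩ | ⟨k, p, x, l, rfl, hk, -⟩
    · exact ⟨w, _, h.simple (hP w le_rfl m (hm.good h.known))⟩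
    · simp [hk] at hc
  | cond_true hφ => obtain ⟨r, M, rfl, hP, -⟩ := h.uncons; exact ⟨w, _, h.simple (hP.1 hφ)⟩
  | cond_false hφ => obtain ⟨r, M, rfl, hP, -⟩ := h.uncons; exact ⟨w, _, h.simple (hP.2 hφ)⟩
  | let2 e => obtain ⟨r, M, rfl, hP, -⟩ := h.uncons; exact ⟨w, _, h.simple (hP.1 _ _ e)⟩
  | let2_else e => obtain ⟨r, M, rfl, hP, -⟩ := h.uncons; exact ⟨w, _, h.simple (hP.2 e)⟩
  | let3 e => obtain ⟨r, M, rfl, hP, -⟩ := h.uncons; exact ⟨w, _, h.simple (hP.1 _ _ _ e)⟩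
  | let3_else e => obtain ⟨r, M, rfl, hP, -⟩ := h.uncons; exact ⟨w, _, h.simple (hP.2 e)⟩
  | let4 e => obtain ⟨r, M, rfl, hP, -⟩ := h.uncons; exact ⟨w, _, h.simple (hP.1 _ _ _ _ e)⟩
  | let4_else e => obtain ⟨r, M, rfl, hP, -⟩ := h.uncons; exact ⟨w, _, h.simple (hP.2 e)⟩
  | @event n S T K L e P =>
    obtain ⟨r, M, rfl, hP, hM⟩ := h.uncons
    obtain ⟨he, hP⟩ := hP w le_rfl
    have hle := w.le_push e
    refine ⟨w.push e, (r, P) ::ₘ M, by simpa using hM, ?_,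
      by simpa using h.valid.mono hle, h.fresh, by simp [World.push, h.log], ?_,
      fun t a b c ht => (h.tables t a b c ht).mono hle, fun m hm => (h.known m hm).mono hle⟩
    · intro x hx
      rcases Multiset.mem_cons.1 hx with rfl | hx
      · exact hP
      · exact (h.safe x (Multiset.mem_cons_of_mem hx)).mono hle
    · rintro (_ | ⟨e', l₁⟩) e'' l₂ hl
      · simp only [List.nil_append, List.cons.injEq] at hl
        have hL : w.log = L := h.log
        rw [← hl.1, ← hl.2, ← hL]
        exact he
      · simp only [List.cons_append, List.cons.injEq] at hl
        exact h.ev l₁ e'' l₂ hl.2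
  | @insert n S T K L t a b c P =>
    obtain ⟨r, M, rfl, hP, -⟩ := h.uncons
    refine ⟨w, _, { h.simple hP.2 with tables := ?_ }⟩
    rintro t' a' b' c' (e | hx)
    · cases e; exact hP.1
    · exact h.tables _ _ _ _ hx
  | get ht hφ =>
    obtain ⟨r, M, rfl, hP, -⟩ := h.uncons
    exact ⟨w, _, h.simple (hP w le_rfl _ _ _ (h.tables _ _ _ _ ht) hφ)⟩

/-- Every event of a safe closed process is executed under its condition. -/
theorem Safe.ev_of_reaches {P : Proc} (hP : Safe σ P ⟨fun _ => none, []⟩ 0) {s : Config}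
    (hs : Reaches P s) : ∀ l₁ e l₂, s.log = l₁ ++ e :: l₂ → σ.ev l₂ e := by
  have h₀ : Inv σ ⟨fun _ => none, []⟩ {(0, P)} ⟨0, {P}, ∅, ∅, []⟩ :=
    ⟨by simp, by simpa using hP, ⟨by simp, fun p => ⟨[], by simp⟩⟩, by simp, rfl, by simp, by simp,
      by simp⟩
  have : ∃ w M, Inv σ w M s := by
    induction hs with
    | refl => exact ⟨_, _, h₀⟩
    | tail _ hs ih =>
      obtain ⟨w, M, h⟩ := ih
      exact h.step hs
  obtain ⟨w, M, h⟩ := this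
  exact h.ev

/-! ### The principals respect the typing -/

section
variable {σ : Setting} {w : World} {r : Multiset Tok}

theorem safe_nil : Safe σ .nil w r := trivial

theorem safe_new_kind (k : Kind) (hk : ∀ n, k.toks n [] = 0) {P : Msg → Proc}
    (h : ∀ w' ≥ w, ∀ n, w'.kind n = some k → Safe σ (P (name n)) w' r) :
    Safe σ (.new P) w r :=
  fun w' hw n hn => ⟨k, [], by
    rw [hk, add_zero]
    exact h _ (hw.trans (World.le_alloc hn k)) n (World.alloc_self _ _ _)⟩

theorem safe_new_pub {P : Msg → Proc}
    (h : ∀ w' ≥ w, ∀ n : Msg, n.Good σ w' → Safe σ (P n) w' r) : Safe σ (.new P) w r :=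
  safe_new_kind .pub (fun _ => rfl) fun w' hw _ hn => h w' hw _ (good_name.2 hn)

/-- The initial history is a free choice. It can record data of the session before any message is
exchanged, as is needed for completeness. -/
theorem safe_new_session (hist : Hist) {P : Msg → Proc}
    (h : ∀ w' ≥ w, ∀ n, w'.kind n = some (.chan n .pch) →
      Safe σ (P (name n)) w' (r + {⟨false, n, hist⟩, ⟨true, n, hist⟩})) :
    Safe σ (.new P) w r :=
  fun w' hw n hn => ⟨.chan n .pch, hist, by
    simpa only [Kind.toks, if_true] using
      h _ (hw.trans (World.le_alloc hn _)) n (World.alloc_self _ _ _)⟩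

theorem safe_repl {P : Proc} (h : Safe σ P w 0) : Safe σ (.repl P) w r := h

theorem safe_inp {c : Msg} {P : Msg → Proc} (hc : c.Good σ w)
    (h : ∀ w' ≥ w, ∀ m, m.Good σ w' → Safe σ (P m) w' r) : Safe σ (.inp c P) w r := .inl ⟨hc, h⟩

theorem safe_out {c m : Msg} {P : Proc} (hc : c.Good σ w) (hm : m.Good σ w) (h : Safe σ P w r) :
    Safe σ (.out c m P) w r := .inl ⟨hc, hm, h⟩

theorem safe_cond {φ : Prop} {P : Proc} (h : φ → Safe σ P w r) : Safe σ (.cond φ P .nil) w r :=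
  ⟨h, fun _ => trivial⟩

theorem safe_event {e : Event} {P : Proc} (he : ∀ w' ≥ w, σ.ev w'.log e)
    (h : ∀ w' ≥ w, e ∈ w'.log → Safe σ P w' r) : Safe σ (.event e P) w r :=
  fun w' hw => ⟨he w' hw, h _ (hw.trans (w'.le_push e)) (by simp [World.push])⟩

theorem safe_let2_decrypt {c k : Msg} {P : Msg → Msg → Proc} (hc : c.Good σ w)
    (h : ∀ a b, decrypt c k = tup2 a b → a.Good σ w → b.Good σ w → Safe σ (P a b) w r) :
    Safe σ (.let2 (decrypt c k) P .nil) w r := by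
  refine ⟨fun a b e => ?_, fun _ => trivial⟩
  have := hc.of_decrypt (isTuple_tup2 a b) e
  rw [good_tup2] at this
  exact h a b e this.1 this.2

theorem safe_let3 {m : Msg} {P : Msg → Msg → Msg → Proc} (hm : m.Good σ w)
    (h : ∀ a b c, m = tup3 a b c → a.Good σ w → b.Good σ w → c.Good σ w → Safe σ (P a b c) w r) :
    Safe σ (.let3 m P .nil) w r := by
  refine ⟨fun a b c e => ?_, fun _ => trivial⟩
  have := e ▸ hm
  rw [good_tup3] at this
  exact h a b c e this.1 this.2.1 this.2.2

theorem safe_let4 {m : Msg} {P : Msg → Msg → Msg → Msg → Proc} (hm : m.Good σ w)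
    (h : ∀ a b c d, m = tup4 a b c d → a.Good σ w → b.Good σ w → c.Good σ w → d.Good σ w →
      Safe σ (P a b c d) w r) :
    Safe σ (.let4 m P .nil) w r := by
  refine ⟨fun a b c d e => ?_, fun _ => trivial⟩
  have := e ▸ hm
  rw [good_tup4] at this
  exact h a b c d e this.1 this.2.1 this.2.2.1 this.2.2.2

@[simp] theorem good_ch : ch.Good σ w := good_const
@[simp] theorem good_bba : bba.Good σ w := good_const
@[simp] theorem good_bbn : bbn.Good σ w := good_const
@[simp] theorem good_roleC : roleC.Good σ w := good_const
@[simp] theorem good_roleE : roleE.Good σ w := good_const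

theorem roleC_ne_roleE : roleC ≠ roleE := by
  rw [Ne, ← nf_inj]; simp [roleC, roleE]

variable (σ) in
/-- The public key of a principal whose key is restricted unless he is corrupted. -/
def PubKey (w : World) (corrupted : Bool) (ty : KeyType) (k : Msg) : Prop :=
  ∃ n, k = pk (name n) ∧ w.kind n = some (if corrupted then .pub else .key ty)

theorem PubKey.mono {w' : World} (h : w ≤ w') {b : Bool} {ty : KeyType} {k : Msg}
    (hk : PubKey w b ty k) : PubKey w' b ty k :=
  let ⟨n, e, hn⟩ := hk; ⟨n, e, World.kind_mono h hn⟩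

theorem PubKey.good {b : Bool} {ty : KeyType} {k : Msg} (hk : PubKey w b ty k) : k.Good σ w := by
  obtain ⟨n, rfl, hn⟩ := hk
  cases b
  · exact good_pk_key hn
  · exact Good.pk (by simpa using hn)

/-- With no corrupted examiners, the table holds only honest keys in the role of examiner, and the
signature certifies this. The exponent has to be a name because the mixnet also signs it alone: a
name is not a triple, so that signature certifies no pseudonym. -/
theorem safe_NET {n n' : ℕ} {pkA : Msg} (hn : w.kind n = some (.key .net)) (hA : pkA.Good σ w)
    (hrc : (name n').Good σ w) : Safe σ (NET (name n) pkA (name n')) w r := by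
  refine safe_inp good_ch fun w₁ h₁ R hR => ?_
  rintro w₂ h₂ R rx pkX ⟨-, hrx, hX, hE⟩ rfl
  have hn₂ := World.kind_mono (h₁.trans h₂) hn
  have hR₂ := hR.mono h₂
  refine safe_out good_bbn ?_ (safe_new_pub fun w₃ h₃ r hr => safe_out good_ch ?_ safe_nil)
  · simp only [good_tup4, good_pseudoPub, good_exp, hX, hrx, hR₂, true_and]
    refine good_sign_key (by simp [hX, hrx, hR₂]) hn₂ ?_
    intro hκ p h e
    simp only [nf_tup3, Term.tup3.injEq] at e
    obtain ⟨n₁, rfl, hk⟩ := hE hκ (by rw [← nf_inj, e.2.2]; rfl)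
    exact ⟨n₁, rx.nf, by simp [← e.1], hk⟩
  · have h₀ := h₁.trans (h₂.trans h₃)
    simp only [good_encrypt, good_tup2, hr, hA.mono h₀, hrc.mono h₀, true_and, and_true]
    exact good_sign_key (hrc.mono h₀) (World.kind_mono h₃ hn₂) (by simp [Auth])

/-- Of the pairs, triples and quadruples that the authority signs, only the pairs carry an
obligation. It is met because the question was logged as generated before it is signed. -/
theorem safe_EA {n : ℕ} {pkN : Msg} (hev : ∀ L q, σ.ev L ⟨.generated, [q]⟩)
    (hn : w.kind n = some (.key .ea)) : Safe σ (EA (name n) pkN) w r := by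
  refine safe_new_pub fun w₁ h₁ ques hq => safe_event (fun _ _ => hev _ _) fun w₂ h₂ hgen => ?_
  refine safe_inp good_bbn fun w₃ h₃ x hx => safe_let4 hx fun pC hc ro spC _ hpC _ _ _ => ?_
  refine safe_cond fun _ => safe_new_pub fun w₄ h₄ r₁ hr₁ => ?_
  have hn : w₄.kind n = some (.key .ea) := World.kind_mono (by order) hn
  have hq : ques.Good σ w₄ := hq.mono (by order)
  have hpC : pC.Good σ w₄ := hpC.mono (by order)
  have hgen : ⟨.generated, [ques]⟩ ∈ w₄.log := World.log_mono (by order) hgen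
  refine safe_out good_bba ?_ (safe_inp good_ch fun w₅ h₅ eca heca => ?_)
  · simp only [good_encrypt, good_tup2, hq, hpC, hr₁, true_and, and_true]
    refine good_sign_key (by simp [hq, hpC]) hn ?_
    intro q p e
    simp only [nf_tup2, Term.tup2.injEq] at e
    rwa [← e.1, mk_nf]
  refine safe_let2_decrypt heca fun ca₀ sca _ hca₀ hsca => safe_let3 hca₀ fun q ans p _ _ hans _ => ?_
  refine safe_cond fun _ => safe_new_pub fun w₆ h₆ r₂ hr₂ => ?_
  have hn : w₆.kind n = some (.key .ea) := World.kind_mono (by order) hn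
  have hq : ques.Good σ w₆ := hq.mono (by order)
  have hpC : pC.Good σ w₆ := hpC.mono (by order)
  have hans : ans.Good σ w₆ := hans.mono (by order)
  refine safe_out good_bba ?_ (safe_inp good_bbn fun w₇ h₇ y hy => ?_)
  · simp only [good_encrypt, good_tup2, good_tup3, hq, hpC, hans, hr₂, true_and, and_true]
    exact good_sign_key (by simp [hq, hpC, hans]) hn (by simp [Auth])
  refine safe_let4 hy fun pE he role spE _ hpE _ _ _ => safe_cond fun _ => ?_
  refine safe_new_pub fun w₈ h₈ r₃ hr₃ => ?_
  have hn : w₈.kind n = some (.key .ea) := World.kind_mono (by order) hn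
  have hpE : pE.Good σ w₈ := hpE.mono (by order)
  have hca : (tup4 ques ans pC pE).Good σ w₈ := by
    simp [hpE, hq.mono (h₇.trans h₈), hans.mono (h₇.trans h₈), hpC.mono (h₇.trans h₈)]
  have hs : (sign (tup4 ques ans pC pE) (name n)).Good σ w₈ := good_sign_key hca hn (by simp [Auth])
  refine safe_out good_bba ?_ (safe_inp good_ch fun w₉ h₉ ema hema => ?_)
  · rw [good_encrypt, good_tup2]
    exact ⟨⟨hca, hs⟩, hpE, hr₃⟩
  refine safe_let2_decrypt hema fun ma sma _ hma hsma => safe_let3 hma fun ca' sca' mark _ _ _ hm => ?_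
  refine safe_cond fun _ => safe_new_pub fun w₁₀ h₁₀ r₄ hr₄ => ?_
  -- The `rfl` is the condition on the table of evaluations: the inserted mark is the correct one by
  -- construction.
  refine safe_out good_bba ?_ (safe_inp good_ch fun w₁₁ h₁₁ _ _ => ⟨rfl, safe_out good_bba ?_ safe_nil⟩)
  · rw [good_encrypt, good_tup2, good_tup3]
    exact ⟨⟨⟨hca.mono (by order), hs.mono (by order), hm.mono h₁₀⟩, hsma.mono h₁₀⟩,
      hpC.mono (by order), hr₄⟩
  · rw [good_tup3, good_correct]
    have hq := hq.mono (show w₆ ≤ w₁₁ by order)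
    have hans := hans.mono (show w₆ ≤ w₁₁ by order)
    exact ⟨hq, hans, hq, hans⟩

theorem safe_Ex {n : ℕ} {pkA pkN mark : Msg} (hn : w.kind n = some (.key .ex))
    (hA : pkA.Good σ w) (hm : mark.Good σ w) : Safe σ (Ex σ.ρ (name n) pkA pkN mark) w r := by
  refine safe_inp good_bbn fun w₁ h₁ x hx => safe_let4 hx fun pE he _ spE _ hpE hhe _ _ => ?_
  refine safe_cond fun _ => safe_cond fun _ => safe_inp good_bba fun w₂ h₂ eca heca => ?_
  refine safe_let2_decrypt heca fun ca sca _ hca hsca => safe_let4 hca fun q a p p' _ hq ha hp _ => ?_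
  refine safe_cond fun _ => safe_new_pub fun w₃ h₃ r hr => safe_out good_ch ?_ safe_nil
  have hma : (tup3 (tup4 q a p pE) sca (σ.ρ.give mark q a)).Good σ w₃ := by
    have hg : (σ.ρ.give mark q a).Good σ w₃ := by
      cases σ.ρ
      · exact hm.mono (by order)
      · exact good_correct.2 ⟨hq.mono h₃, ha.mono h₃⟩
    rw [good_tup3, good_tup4]
    exact ⟨⟨hq.mono h₃, ha.mono h₃, hp.mono h₃, hpE.mono (by order)⟩, hsca.mono h₃, hg⟩
  rw [good_encrypt, good_tup2]
  refine ⟨⟨hma, good_sign_pseudo hma (World.kind_mono (by order) hn) ?_⟩, hA.mono (by order), hr⟩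
  intro hρ q' a' i e s k h
  simp only [hρ, Marking.give, nf_tup3, nf_tup4, nf_correct, Term.tup3.injEq, Term.tup4.injEq] at h
  rw [← h.2.2, h.1.1, h.1.2.1]

/-- The evidence of the question that a candidate has. -/
def QuestionOK (pkA privC ques eques : Msg) : Prop :=
  ∃ sques pC, decrypt eques privC = tup2 ques sques ∧ checksign sques pkA = tup2 ques pC

/-- The evidence of the receipt and of the notification that a candidate has at the end. -/
structure View.OK (pkA : Msg) (v : View) : Prop where
  receipt : ∃ sca, decrypt v.receipt v.privC = tup2 (tup3 v.ques v.ans v.pseudoC) sca ∧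
    checksign sca pkA = tup3 v.ques v.ans v.pseudoC
  notif : ∃ sca sma, decrypt v.notif v.privC =
      tup2 (tup3 (tup4 v.ques v.ans v.pseudoC v.pseudoE) sca v.mark) sma ∧
    checksign sca pkA = tup4 v.ques v.ans v.pseudoC v.pseudoE ∧
    checksign sma v.pseudoE = tup3 (tup4 v.ques v.ans v.pseudoC v.pseudoE) sca v.mark

/-- A chain of two signatures: that of the mixnet shows that the pseudonym belongs to the restricted
key of an honest examiner, and a mark signed under such a key is correct. -/
theorem mark_eq_of_checksign {pkN pE he spE q a i e s m sma : Msg} (hκ : σ.κ.examiners = false)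
    (hκ' : σ.κ.net = false) (hρ : σ.ρ = .correct) (hN : PubKey w σ.κ.net .net pkN)
    (hspE : spE.Good σ w) (hsma : sma.Good σ w) (h : tup3 pE he roleE = checksign spE pkN)
    (h' : tup3 (tup4 q a i e) s m = checksign sma pE) : m = correct q a := by
  obtain ⟨n, rfl, hn⟩ := hN
  rw [hκ'] at hn
  rw [(isTuple_tup3 _ _ _).checksign_pk h.symm] at hspE
  obtain ⟨k, x, hp, hk⟩ := auth_of_good_sign hspE hn hκ pE.nf he.nf (by simp [roleE])
  obtain rfl : pE = pseudoPub (pk (name k)) (mk x) := by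
    rw [← mk_nf pE, hp]; rfl
  rw [(isTuple_tup3 _ _ _).checksign_pseudoPub h'.symm] at hsma
  have := auth_of_good_sign_pseudo hsma hk hρ q.nf a.nf i.nf e.nf s.nf m.nf (by simp)
  rw [← nf_inj, this, nf_correct]

/-- The tokens are divided among the three reports. The hypotheses `hq` and `hn` supply their
reports with what the checks of the candidate have established by then. -/
theorem safe_Cand {R : Report} {rq rs rn : Multiset Tok} {skC pkA pkN ans : Msg}
    (hevc : ∀ L l, σ.ev L ⟨.correct, l⟩)
    (hC : skC.Good σ w) (hA : pkA.Good σ w) (hN : PubKey w σ.κ.net .net pkN) (hans : ans.Good σ w)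
    (hq : ∀ w' ≥ w, ∀ privC ques eques, QuestionOK pkA privC ques eques →
      Safe σ (R.question privC ques eques) w' rq)
    (hs : ∀ w' ≥ w, ∀ privC pC ques ans, Safe σ (R.submission privC pC ques ans) w' rs)
    (hn : ∀ w' ≥ w, ∀ v : View, v.OK pkA → ⟨.correct, [v.ques, v.ans, v.mark]⟩ ∈ w'.log →
      (σ.κ.examiners = false → σ.κ.net = false → σ.ρ = .correct → v.mark = correct v.ques v.ans) →
      Safe σ (R.notification v) w' rn) :
    Safe σ (Cand R skC pkA pkN ans) w (rq + (rs + rn)) := by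
  refine safe_inp good_bbn fun w₁ h₁ x hx => safe_let4 hx fun pC hc ro spC _ hpC hhc _ _ => ?_
  refine safe_cond fun _ => safe_cond fun _ => safe_inp good_bba fun w₂ h₂ eques heques => ?_
  refine safe_let2_decrypt heques fun ques sques hdq hques hsques => safe_cond fun hcq => ?_
  refine ⟨rq, rs + rn, le_rfl, hq w₂ (by order) _ _ _ ⟨_, _, hdq, hcq.symm⟩, ?_⟩
  refine safe_new_pub fun w₃ h₃ r₁ hr₁ => safe_out good_ch ?_ ⟨rs, rn, le_rfl, hs w₃ (by order) _ _ _ _, ?_⟩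
  · have hca : (tup3 ques ans pC).Good σ w₃ := by
      rw [good_tup3]; exact ⟨hques.mono h₃, hans.mono (by order), hpC.mono (by order)⟩
    rw [good_encrypt, good_tup2]
    exact ⟨⟨hca, hca.sign (good_pseudoPriv.2 ⟨hC.mono (by order), hhc.mono (by order)⟩)⟩,
      hA.mono (by order), hr₁⟩
  refine safe_inp good_bba fun w₄ h₄ eca' heca => ?_
  refine safe_let2_decrypt heca fun ca' sca' hdr _ _ => safe_cond fun hcr => ?_
  refine safe_inp good_bba fun w₅ h₅ ema' hema => safe_inp good_bbn fun w₆ h₆ y hy => ?_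
  refine safe_let4 hy fun pE he role spE _ hpE _ _ hspE => safe_cond fun hcE => ?_
  refine safe_let2_decrypt (hema.mono h₆) fun ma sma hdn hma hsma => ?_
  refine safe_let3 hma fun ca'' sca'' mark hma' _ _ _ => safe_cond fun hcn => ?_
  refine safe_event (fun _ _ => hevc _ _) fun w₇ h₇ hlog => hn w₇ (by order) _ ⟨?_, ?_⟩ hlog ?_
  · exact ⟨sca', by rw [hdr, hcr.1], hcr.2.symm⟩
  · exact ⟨sca'', sma, by rw [hdn, hma', hcn.1], by rw [← hcn.2.1, hcn.1], hcn.2.2.symm⟩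
  · exact fun hκ hκ' hρ => mark_eq_of_checksign hκ hκ' hρ (hN.mono (show w ≤ w₆ by order)) hspE hsma
      hcE hcn.2.2

/-- The key of a corrupted authority or mixnet has kind `pub`: handing it over is well typed, and
its signatures carry no guarantee. Candidates are replicated, so they start without tokens and
obtain them by opening sessions of their own. -/
theorem safe_exam {cand : Msg → Msg → Msg → Msg → Proc}
    (hev : ∀ L q, σ.ev L ⟨.generated, [q]⟩)
    (hc : ∀ w skC pkA pkN ans, skC.Good σ w → PubKey w σ.κ.ea .ea pkA → PubKey w σ.κ.net .net pkN →
      ans.Good σ w → Safe σ (cand skC pkA pkN ans) w 0) :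
    Safe σ (exam σ.κ σ.ρ cand) w r := by
  -- The exponent `rc` is kept as a name, as `safe_NET` requires.
  refine safe_repl (safe_new_kind .pub (fun _ => rfl) fun w₁ h₁ rc hrc => ?_)
  refine safe_new_pub fun w₂ h₂ re hre => ?_
  refine safe_new_kind (if σ.κ.ea then .pub else .key .ea) (fun n => by cases σ.κ.ea <;> rfl)
    fun w₃ h₃ nA hnA => ?_
  have hA : PubKey w₃ σ.κ.ea .ea (pk (name nA)) := ⟨nA, rfl, hnA⟩
  refine safe_out good_ch hA.good ?_
  refine safe_new_kind (if σ.κ.net then .pub else .key .net) (fun n => by cases σ.κ.net <;> rfl)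
    fun w₄ h₄ nN hnN => ?_
  have hN : PubKey w₄ σ.κ.net .net (pk (name nN)) := ⟨nN, rfl, hnN⟩
  have hA := hA.mono h₄
  have hnA := World.kind_mono h₄ hnA
  have hrc : (name rc).Good σ w₄ := good_name.2 (World.kind_mono (by order) hrc)
  have hre : re.Good σ w₄ := hre.mono (by order)
  refine safe_out good_ch hN.good ?_
  refine ⟨0, 0, by simp, ?_, 0, 0, by simp, ?_, 0, 0, by simp, ?_, 0, 0, by simp, ?_, 0, 0, by simp,
    ?_, ?_⟩
  · cases hκ : σ.κ.net
    · exact safe_NET (by simpa [hκ] using hnN) hA.good hrc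
    · exact safe_out good_ch (good_tup3.2 ⟨good_name.2 (hnN.trans (by simp [hκ])), hrc, hre⟩) safe_nil
  · cases hκ : σ.κ.ea
    · exact safe_EA hev (by simpa [hκ] using hnA)
    · exact safe_out good_ch (by simpa [hκ] using hnA) safe_nil
  · refine safe_repl (safe_new_pub fun w₅ h₅ skC hC => safe_out good_ch hC.pk ?_)
    refine safe_new_pub fun w₆ h₆ ans hans => ⟨⟨good_roleC, hrc.mono (by order),
      hC.pk.mono h₆, fun _ e => absurd e roleC_ne_roleE⟩, ?_⟩
    exact hc w₆ _ _ _ _ (hC.mono h₆) (hA.mono (by order)) (hN.mono (by order)) hans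
  · refine safe_repl (safe_new_kind (.key .ex) (fun _ => rfl) fun w₅ h₅ n hn => ?_)
    refine safe_out good_ch (good_pk_key hn) (safe_new_pub fun w₆ h₆ mark hm => ?_)
    have hn := World.kind_mono h₆ hn
    exact ⟨⟨good_roleE, hre.mono (by order), good_pk_key hn, fun _ _ => ⟨n, rfl, hn⟩⟩,
      safe_Ex hn (hA.good.mono (by order)) hm⟩
  · cases hκ : σ.κ.candidates
    · exact safe_nil
    · exact safe_inp good_ch fun w₅ h₅ k hk => ⟨⟨good_roleC, hrc.mono h₅, hk,
        fun _ e => absurd e roleC_ne_roleE⟩, safe_nil⟩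
  · cases hκ : σ.κ.examiners
    · exact safe_nil
    · exact safe_inp good_ch fun w₅ h₅ k hk => ⟨⟨good_roleE, hre.mono h₅, hk,
        fun e => by simp [hκ] at e⟩, safe_nil⟩

end

/-! ### Soundness -/

section
variable {σ : Setting} {w : World} {r : Multiset Tok} {n p : ℕ} {x : Chan} {h : Hist}

theorem safe_send {m : Msg} {P : Proc} (hn : w.kind n = some (.chan p x))
    (hs : σ.sp w.log ((x, m) :: h)) (hP : Safe σ P w {⟨false, p, (x, m) :: h⟩}) :
    Safe σ (.out (name n) m P) w {⟨false, p, h⟩} := .inr ⟨n, p, x, h, rfl, hn, rfl, hs, hP⟩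

theorem safe_receive {P : Msg → Proc} (hn : w.kind n = some (.chan p x))
    (hP : ∀ w' ≥ w, ∀ m, σ.sp w'.log ((x, m) :: h) → Safe σ (P m) w' {⟨true, p, (x, m) :: h⟩}) :
    Safe σ (.inp (name n) P) w {⟨true, p, h⟩} := .inr ⟨n, p, x, h, rfl, hn, rfl, hP⟩

theorem safe_OK {args : List Msg} (he : ∀ w' ≥ w, σ.ev w'.log ⟨.OK, args⟩) :
    Safe σ (OK args) w r := safe_event he fun _ _ _ => safe_nil

end

/-- What must have been executed before `OK` in a sound test. -/
def Requirement.Sound (κ : Corruption) : Requirement → List Event → List Msg → Prop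
  | .QV, L, args => κ.ea = false → ∀ q, args = [q] → ⟨.generated, [q]⟩ ∈ L
  | .MC, L, args => ∀ q a m, args = [q, a, m] → ⟨.correct, [q, a, m]⟩ ∈ L ∧ Msg.correct q a = m
  | .TI, L, args => ∀ i q a, args = [i, q, a] →
      ⟨.marked, [i, q, a]⟩ ∈ L ∧ ⟨.accepted, [i, q, a]⟩ ∈ L
  | .TM, L, args => ∀ i q a, args = [i, q, a] → ⟨.marked, [i, q, a]⟩ ∈ L
  | .MI, L, args => ∀ i q a m, args = [i, q, a, m] →
      ⟨.marked, [i, q, a, m]⟩ ∈ L ∧ ⟨.assigned, [i, q, a, m]⟩ ∈ L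
  | .MNI, L, args => ∀ i m, args = [i, m] → ⟨.assigned, [i, m]⟩ ∈ L

/-- The setting in which soundness is examined. -/
def Requirement.soundSetting (R : Requirement) (κ : Corruption) (ρ : Marking) : Setting where
  κ := κ
  ρ := ρ
  ev L e := e.label = .OK → R.Sound κ L e.args
  sp L h := R = .MC → ∀ q a m, (Chan.pch, tup3 q a m) ∈ h → ⟨.correct, [q, a, m]⟩ ∈ L
  sp_mono := @fun _ _ _ hL hs hR q a m hm => hL.subset (hs hR q a m hm)

/-! ### The tests and the candidate in the soundness setting. -/

section
variable {κ : Corruption} {ρ : Marking} {w : World} {n : ℕ} {pkA : Msg}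

theorem ev_sound {R : Requirement} {l : EventName} (hl : l ≠ .OK) {L : List Event}
    {args : List Msg} : (R.soundSetting κ ρ).ev L ⟨l, args⟩ := fun h => absurd h hl

theorem safe_KO_sound {R : Requirement} {r : Multiset Tok} :
    Safe (R.soundSetting κ ρ) KO w r :=
  safe_event (fun _ _ => ev_sound (by nofun)) fun _ _ _ => safe_nil

/-- The post is read from a public channel, hence good, and so is the signature in it, whatever
private key was supplied. By unforgeability, a pair signed with the authority's restricted key
contains a generated question. -/
theorem safe_testQV (hn : w.kind n = some (.chan n .pch))
    (hA : PubKey w κ.ea .ea pkA) :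
    Safe (Requirement.QV.soundSetting κ ρ) (testQV pkA (name n) bbn bba) w {⟨true, n, []⟩} := by
  refine safe_inp good_bba fun w₁ h₁ eques he => ?_
  refine safe_receive (World.kind_mono h₁ hn) fun w₂ h₂ x _ => ?_
  refine ⟨fun ques privC _ => ⟨fun ques' sques e => ⟨fun q' pC e' => ⟨fun hq => ?_, fun _ => ?_⟩,
    fun _ => ?_⟩, fun _ => ?_⟩, fun _ => ?_⟩
  case refine_1 =>
    refine safe_OK fun w₃ h₃ _ hκ q hargs => ?_
    obtain rfl : ques = q := by simpa using hargs
    obtain ⟨k, rfl, hk⟩ := hA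
    rw [hκ] at hk
    have hs := (good_tup2.1 (he.of_decrypt (isTuple_tup2 _ _) e)).2
    rw [(isTuple_tup2 _ _).checksign_pk e'] at hs
    have := auth_of_good_sign hs (World.kind_mono h₁ hk) q'.nf pC.nf (by simp)
    rw [mk_nf, hq.2, hq.1] at this
    exact World.log_mono (by order) this
  all_goals exact safe_KO_sound

/-- The history of the private channel shows that the mark was accepted, the table shows that its
own mark is correct, and the final comparison identifies the two. -/
theorem safe_testMC (hn : w.kind n = some (.chan n .pch)) :
    Safe (Requirement.MC.soundSetting κ ρ) (testMC pkA (name n) bbn bba) w {⟨true, n, []⟩} := by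
  refine safe_receive hn fun w₁ h₁ x hx => ⟨fun ques ans mark e => ?_, fun _ => safe_KO_sound⟩
  intro w₂ h₂ q a m hm hqa
  refine ⟨fun hmm => safe_OK fun w₃ h₃ _ q' a' m' hargs => ?_, fun _ => safe_KO_sound⟩
  simp only [List.cons.injEq, and_true] at hargs
  obtain ⟨rfl, rfl, rfl⟩ := hargs
  refine ⟨World.log_mono (by order) (hx rfl ques ans mark (by simp [e])), ?_⟩
  rw [← hmm, ← hqa.1, ← hqa.2]
  exact hm.symm

/-- No cryptography is involved: the events lie on every path to `OK`, and the final comparison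
forces their arguments. The same holds for the three tests below. -/
theorem safe_testTI (hn : w.kind n = some (.chan n .pch)) :
    Safe (Requirement.TI.soundSetting κ ρ) (testTI pkA (name n) bbn bba) w {⟨true, n, []⟩} := by
  refine safe_receive hn fun w₁ h₁ x _ => ⟨fun privC ques ans pC _ => ?_, fun _ => safe_KO_sound⟩
  refine safe_inp good_bbn fun w₂ h₂ y _ => ⟨fun pE _ _ _ _ => ?_, fun _ => safe_KO_sound⟩
  refine safe_inp good_bba fun w₃ h₃ eca _ => safe_inp good_bba fun w₄ h₄ ema _ => ?_
  refine ⟨fun _ sca _ => ⟨fun q₁ a₁ p₁ _ => ?_, fun _ => safe_KO_sound⟩, fun _ => safe_KO_sound⟩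
  refine safe_event (fun _ _ => ev_sound (by nofun)) fun w₅ h₅ hacc => ?_
  refine ⟨fun ma sma _ => ⟨fun ca₂ sca₂ _ _ => ⟨fun q₂ a₂ p₂ e₂ _ => ⟨fun ca₃ sca₃ _ _ =>
    ⟨fun q₃ a₃ p₃ e₃ _ => ?_, fun _ => safe_KO_sound⟩, fun _ => safe_KO_sound⟩,
    fun _ => safe_KO_sound⟩, fun _ => safe_KO_sound⟩, fun _ => safe_KO_sound⟩
  refine safe_event (fun _ _ => ev_sound (by nofun)) fun w₆ h₆ hmar => ?_
  refine ⟨?_, fun _ => safe_KO_sound⟩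
  rintro ⟨rfl, rfl, rfl, -, -, -, -, -, rfl, rfl, rfl, -⟩
  refine safe_OK fun w₇ h₇ _ i q a hargs => ?_
  rw [← hargs]
  exact ⟨World.log_mono (by order) hmar, World.log_mono (by order) hacc⟩

theorem safe_testTM (hn : w.kind n = some (.chan n .pch)) :
    Safe (Requirement.TM.soundSetting κ ρ) (testTM pkA (name n) bbn bba) w {⟨true, n, []⟩} := by
  refine safe_receive hn fun w₁ h₁ x _ => ⟨fun privC ques ans pC _ => ?_, fun _ => safe_KO_sound⟩
  refine safe_inp good_bbn fun w₂ h₂ y _ => ⟨fun pE _ _ _ _ => ?_, fun _ => safe_KO_sound⟩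
  refine safe_inp good_bba fun w₃ h₃ ema _ => ?_
  refine ⟨fun ma sma _ => ⟨fun ca₂ sca₂ _ _ => ⟨fun q₂ a₂ p₂ e₂ _ => ⟨fun ca₃ sca₃ _ _ =>
    ⟨fun q₃ a₃ p₃ e₃ _ => ?_, fun _ => safe_KO_sound⟩, fun _ => safe_KO_sound⟩,
    fun _ => safe_KO_sound⟩, fun _ => safe_KO_sound⟩, fun _ => safe_KO_sound⟩
  refine safe_event (fun _ _ => ev_sound (by nofun)) fun w₆ h₆ hmar => ?_
  refine ⟨?_, fun _ => safe_KO_sound⟩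
  rintro ⟨-, -, -, -, -, rfl, rfl, rfl, -⟩
  refine safe_OK fun w₇ h₇ _ i q a hargs => ?_
  rw [← hargs]
  exact World.log_mono (by order) hmar

theorem safe_testMI (hn : w.kind n = some (.chan n .pch)) :
    Safe (Requirement.MI.soundSetting κ ρ) (testMI pkA (name n) bbn bba) w {⟨true, n, []⟩} := by
  refine safe_receive hn fun w₁ h₁ x _ => ⟨fun privC ques ans pC _ => ?_, fun _ => safe_KO_sound⟩
  refine safe_inp good_bbn fun w₂ h₂ y _ => ⟨fun pE _ _ _ _ => ?_, fun _ => safe_KO_sound⟩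
  refine safe_inp good_bba fun w₃ h₃ ema _ => ?_
  refine ⟨fun ma sma _ => ⟨fun ca₁ sca₁ mark _ => ⟨fun q₁ a₁ p₁ e₁ _ => ⟨fun _ => ?_,
    fun _ => safe_KO_sound⟩, fun _ => safe_KO_sound⟩, fun _ => safe_KO_sound⟩,
    fun _ => safe_KO_sound⟩
  refine safe_event (fun _ _ => ev_sound (by nofun)) fun w₅ h₅ hass => ?_
  refine ⟨fun ca₂ _ mark' _ => ⟨fun q₂ a₂ p₂ e₂ _ => ?_, fun _ => safe_KO_sound⟩,
    fun _ => safe_KO_sound⟩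
  refine safe_event (fun _ _ => ev_sound (by nofun)) fun w₆ h₆ hmar => ?_
  refine ⟨?_, fun _ => safe_KO_sound⟩
  rintro ⟨rfl, rfl, rfl, -, rfl, rfl, rfl, -, rfl⟩
  refine safe_OK fun w₇ h₇ _ i q a m hargs => ?_
  rw [← hargs]
  exact ⟨World.log_mono (by order) hmar, World.log_mono (by order) hass⟩

theorem safe_testMNI (hn : w.kind n = some (.chan n .pch)) :
    Safe (Requirement.MNI.soundSetting κ ρ) (testMNI pkA (name n) bbn bba) w {⟨true, n, []⟩} := by
  refine safe_receive hn fun w₁ h₁ x _ => ⟨fun privC mark pC _ _ => ?_, fun _ => safe_KO_sound⟩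
  refine safe_inp good_bba fun w₂ h₂ ema _ => ?_
  refine ⟨fun ma sma _ => ⟨fun ca sca mark' _ => ⟨fun q a p e _ => ⟨fun _ => ?_,
    fun _ => safe_KO_sound⟩, fun _ => safe_KO_sound⟩, fun _ => safe_KO_sound⟩,
    fun _ => safe_KO_sound⟩
  refine safe_event (fun _ _ => ev_sound (by nofun)) fun w₃ h₃ hass => ?_
  refine ⟨?_, fun _ => safe_KO_sound⟩
  rintro ⟨rfl, rfl⟩
  refine safe_OK fun w₄ h₄ _ i m hargs => ?_
  rw [← hargs]
  exact World.log_mono (by order) hass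

theorem safe_test_sound (R : Requirement) (hn : w.kind n = some (.chan n .pch))
    (hA : PubKey w κ.ea .ea pkA) :
    Safe (R.soundSetting κ ρ) (R.test pkA (name n) bbn bba) w {⟨true, n, []⟩} := by
  cases R
  exacts [safe_testQV hn hA, safe_testMC (pkA := pkA) hn, safe_testTI hn, safe_testTM hn, safe_testMI hn,
    safe_testMNI hn]

/-- The single sending token is given to the one report that uses the private channel; the other two
are silent. -/
theorem safe_Cand_sound (R : Requirement) {skC pkN ans : Msg} (hn : w.kind n = some (.chan n .pch))
    (hC : skC.Good (R.soundSetting κ ρ) w) (hA : pkA.Good (R.soundSetting κ ρ) w)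
    (hN : PubKey w κ.net .net pkN) (hans : ans.Good (R.soundSetting κ ρ) w) :
    Safe (R.soundSetting κ ρ) (Cand (R.report (name n)) skC pkA pkN ans) w {⟨false, n, []⟩} := by
  have key : ∀ w' ≥ w, ∀ m, ((R.soundSetting κ ρ).sp w'.log [(.pch, m)]) →
      Safe (R.soundSetting κ ρ) (.out (name n) m .nil) w' {⟨false, n, []⟩} :=
    fun w' hw m hm => safe_send (World.kind_mono hw hn) hm safe_nil
  have split : ∀ rq rs rn : Multiset Tok, rq + (rs + rn) = {⟨false, n, []⟩} →
      (∀ w' ≥ w, ∀ a b c, Safe (R.soundSetting κ ρ) ((R.report (name n)).question a b c) w' rq) →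
      (∀ w' ≥ w, ∀ a b c d,
        Safe (R.soundSetting κ ρ) ((R.report (name n)).submission a b c d) w' rs) →
      (∀ w' ≥ w, ∀ v : View, ⟨.correct, [v.ques, v.ans, v.mark]⟩ ∈ w'.log →
        Safe (R.soundSetting κ ρ) ((R.report (name n)).notification v) w' rn) →
      Safe (R.soundSetting κ ρ) (Cand (R.report (name n)) skC pkA pkN ans) w {⟨false, n, []⟩} :=
    fun rq rs rn e hq hs hv => e ▸ safe_Cand (fun _ _ => ev_sound (by nofun)) hC hA hN hans
      (fun w' hw a b c _ => hq w' hw a b c) hs (fun w' hw v _ hl _ => hv w' hw v hl)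
  cases R
  case QV =>
    exact split _ 0 0 rfl (fun w' hw _ _ _ => key w' hw _ nofun) (fun _ _ _ _ _ _ => safe_nil)
      fun _ _ _ _ => safe_nil
  case MC =>
    refine split 0 0 _ (by simp) (fun _ _ _ _ _ => safe_nil) (fun _ _ _ _ _ _ => safe_nil)
      fun w' hw v hv => key w' hw _ ?_
    -- The history consists of the triple just sent, whose acceptance is already in the log.
    rintro - q a m hm
    simp only [List.mem_singleton, Prod.mk.injEq, tup3_inj, true_and] at hm
    rwa [hm.1, hm.2.1, hm.2.2]
  case MNI =>
    exact split 0 0 _ (by simp) (fun _ _ _ _ _ => safe_nil) (fun _ _ _ _ _ _ => safe_nil)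
      fun w' hw _ _ => key w' hw _ nofun
  all_goals
    exact split 0 _ 0 (by simp) (fun _ _ _ _ _ => safe_nil) (fun w' hw _ _ _ _ => key w' hw _ nofun)
      fun _ _ _ _ => safe_nil

theorem sound_of_reaches {R : Requirement} {s : Config} (hs : Reaches (soundnessProc R κ ρ) s)
    {l₁ l₂ : List Event} {args : List Msg} (hl : s.log = l₁ ++ ⟨.OK, args⟩ :: l₂) :
    R.Sound κ l₂ args := by
  refine Safe.ev_of_reaches (σ := R.soundSetting κ ρ) ?_ hs l₁ _ l₂ hl rfl
  refine safe_exam (σ := R.soundSetting κ ρ) (fun _ _ => ev_sound (by nofun))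
    fun w skC pkA pkN ans hC hA hN hans => ?_
  refine safe_new_session [] fun w₁ h₁ n hn => ⟨{⟨false, n, []⟩}, _, by simp, ?_, safe_test_sound R hn
    (hA.mono h₁)⟩
  exact safe_Cand_sound R hn (hC.mono h₁) (hA.good.mono h₁) (hN.mono h₁) (hans.mono h₁)

end

/-! ### Honest runs do not fail -/

/-- The messages that the candidate passes to the test in an honest run, latest first. -/
noncomputable def Requirement.fullHist : Requirement → View → Hist
  | .QV, v => [(.pch, tup2 v.ques v.privC), (.ba, v.eques)]
  | .MC, v => [(.pch, tup3 v.ques v.ans v.mark)]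
  | .TI, v => [(.ba, v.notif), (.ba, v.receipt), (.bn, tup4 v.pseudoE v.he v.role v.spseE),
      (.pch, tup4 v.privC v.ques v.ans v.pseudoC)]
  | .TM, v | .MI, v => [(.ba, v.notif), (.bn, tup4 v.pseudoE v.he v.role v.spseE),
      (.pch, tup4 v.privC v.ques v.ans v.pseudoC)]
  | .MNI, v => [(.ba, v.notif), (.pch, tup4 v.privC v.mark v.pseudoC v.notif)]

/-- What the candidate knows about these messages. -/
def Requirement.Evidence (pkA : Msg) (v : View) : Requirement → Prop
  | .QV => QuestionOK pkA v.privC v.ques v.eques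
  | .MC => v.mark = correct v.ques v.ans
  | .TI | .TM | .MI | .MNI => v.OK pkA

/-- The setting in which completeness is examined. The histories start with the public key of the
exam authority. -/
noncomputable def Requirement.completeSetting (R : Requirement) (ρ : Marking) : Setting where
  κ := .none
  ρ := ρ
  ev _ e := e.label ≠ .KO
  sp _ h := ∃ pkA l v, h = l ++ [(.pch, pkA)] ∧ R.Evidence pkA v ∧ l <:+ R.fullHist v
  sp_mono _ h := h

/-! ### The tests and the candidate in the completeness setting. -/

section
variable {R : Requirement} {ρ : Marking} {w : World} {n n₁ n₂ : ℕ} {pkA : Msg}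

/-- The last entry of the history is not a message but the key of the authority. It ensures that the
sender's evidence concerns the key with which the test verifies. -/
theorem evidence_of_sp {L : List Event} (l : Hist)
    (h : (R.completeSetting ρ).sp L (l ++ [(.pch, pkA)])) :
    ∃ v, R.Evidence pkA v ∧ l <:+ R.fullHist v := by
  obtain ⟨pkA', l', v, e, h⟩ := h
  obtain ⟨rfl, e'⟩ := List.append_inj' e rfl
  obtain rfl : pkA = pkA' := by simpa using e'
  exact ⟨v, h⟩

theorem ev_complete {l : EventName} (hl : l ≠ .KO) {L : List Event} {args : List Msg} :
    (R.completeSetting ρ).ev L ⟨l, args⟩ := hl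

theorem safe_OK_complete {args : List Msg} {r : Multiset Tok} :
    Safe (R.completeSetting ρ) (OK args) w r := safe_OK fun _ _ => ev_complete (by nofun)

theorem safe_testQV_complete (h : w.kind n = some (.chan n .pch))
    (h₂ : w.kind n₂ = some (.chan n .ba)) :
    Safe (Requirement.QV.completeSetting ρ) (testQV pkA (name n) (name n₁) (name n₂)) w
      {⟨true, n, [(.pch, pkA)]⟩} := by
  refine safe_receive h₂ fun w₁ hw₁ eques _ => safe_receive (World.kind_mono hw₁ h) fun w₂ _ x hx => ?_
  -- Two messages are the whole prescribed sequence, so the suffix is all of it and determines the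
  -- data.
  obtain ⟨v, ⟨sques, pC, e₁, e₂⟩, hv⟩ := evidence_of_sp [_, _] hx
  simp [Requirement.fullHist, List.suffix_cons_iff] at hv
  obtain ⟨rfl, rfl⟩ := hv
  refine ⟨fun q k e => ?_, fun e => (e _ _ rfl).elim⟩
  obtain ⟨rfl, rfl⟩ := tup2_inj.1 e
  refine ⟨fun q' s e => ?_, fun e => (e _ _ e₁).elim⟩
  obtain ⟨rfl, rfl⟩ := tup2_inj.1 (e₁.symm.trans e)
  refine ⟨fun q'' p e => ?_, fun e => (e _ _ e₂).elim⟩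
  obtain ⟨rfl, rfl⟩ := tup2_inj.1 (e₂.symm.trans e)
  exact ⟨fun _ => safe_OK_complete, fun e => (e ⟨rfl, rfl⟩).elim⟩

theorem safe_testMC_complete (h : w.kind n = some (.chan n .pch)) :
    Safe (Requirement.MC.completeSetting ρ) (testMC pkA (name n) (name n₁) (name n₂)) w
      {⟨true, n, [(.pch, pkA)]⟩} := by
  refine safe_receive h fun w₁ _ x hx => ?_
  obtain ⟨v, he, hv⟩ := evidence_of_sp [_] hx
  simp [Requirement.fullHist, List.suffix_cons_iff] at hv
  obtain rfl := hv
  refine ⟨fun q a m e => ?_, fun e => (e _ _ _ rfl).elim⟩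
  obtain ⟨rfl, rfl, rfl⟩ := tup3_inj.1 e
  rintro w₂ _ _ _ m hm ⟨rfl, rfl⟩
  -- The mark of the table and the mark of the candidate are both the correct one.
  exact ⟨fun _ => safe_OK_complete, fun e => (e (Eq.trans hm (Eq.symm he))).elim⟩

/-- Each receipt yields a view of its own. The earlier ones serve only to show that a message has
the expected shape; the view at the last receipt accounts for the complete sequence. Every later
check then repeats one made by the candidate, so its failing branch is contradictory. -/
theorem safe_testTI_complete (h : w.kind n = some (.chan n .pch))
    (h₁ : w.kind n₁ = some (.chan n .bn)) (h₂ : w.kind n₂ = some (.chan n .ba)) :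
    Safe (Requirement.TI.completeSetting ρ) (testTI pkA (name n) (name n₁) (name n₂)) w
      {⟨true, n, [(.pch, pkA)]⟩} := by
  refine safe_receive h fun w₁ hw₁ x hx => ?_
  refine ⟨fun privC ques ans pC ex => ?_, fun e => ?_⟩
  swap
  · obtain ⟨v, -, hv⟩ := evidence_of_sp [_] hx
    simp [Requirement.fullHist, List.suffix_cons_iff] at hv
    exact (e _ _ _ _ hv).elim
  refine safe_receive (World.kind_mono hw₁ h₁) fun w₂ hw₂ y hy => ?_
  refine ⟨fun pE he role spE ey => ?_, fun e => ?_⟩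
  swap
  · obtain ⟨v, -, hv⟩ := evidence_of_sp [_, _] hy
    simp [Requirement.fullHist, List.suffix_cons_iff] at hv
    exact (e _ _ _ _ hv.1).elim
  refine safe_receive (World.kind_mono (by order) h₂) fun w₃ hw₃ eca _ => ?_
  refine safe_receive (World.kind_mono (by order) h₂) fun w₄ hw₄ ema hz => ?_
  obtain ⟨v, ⟨⟨sca, e₁, e₂⟩, sca', sma, e₃, e₄, e₅⟩, hv⟩ := evidence_of_sp [_, _, _, _] hz
  simp [Requirement.fullHist, List.suffix_cons_iff] at hv
  obtain ⟨rfl, rfl, rfl, rfl⟩ := hv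
  obtain ⟨rfl, rfl, rfl, rfl⟩ := tup4_inj.1 ex
  obtain ⟨rfl, rfl, rfl, rfl⟩ := tup4_inj.1 ey
  refine ⟨fun _ s e => ?_, fun e => (e _ _ e₁).elim⟩
  obtain ⟨rfl, rfl⟩ := tup2_inj.1 (e₁.symm.trans e)
  refine ⟨fun q a p e => ?_, fun e => (e _ _ _ e₂).elim⟩
  obtain ⟨rfl, rfl, rfl⟩ := tup3_inj.1 (e₂.symm.trans e)
  refine safe_event (fun _ _ => ev_complete (by nofun)) fun w₅ _ _ => ?_
  refine ⟨fun _ _ e => ?_, fun e => (e _ _ e₃).elim⟩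
  obtain ⟨rfl, rfl⟩ := tup2_inj.1 (e₃.symm.trans e)
  refine ⟨fun _ _ _ e => ?_, fun e => (e _ _ _ rfl).elim⟩
  obtain ⟨rfl, rfl, rfl⟩ := tup3_inj.1 e
  refine ⟨fun _ _ _ _ e => ?_, fun e => (e _ _ _ _ rfl).elim⟩
  obtain ⟨rfl, rfl, rfl, rfl⟩ := tup4_inj.1 e
  refine ⟨fun _ _ _ e => ?_, fun e => (e _ _ _ e₅).elim⟩
  obtain ⟨rfl, rfl, rfl⟩ := tup3_inj.1 (e₅.symm.trans e)
  refine ⟨fun _ _ _ _ e => ?_, fun e => (e _ _ _ _ rfl).elim⟩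
  obtain ⟨rfl, rfl, rfl, rfl⟩ := tup4_inj.1 e
  refine safe_event (fun _ _ => ev_complete (by nofun)) fun w₆ _ _ => ?_
  exact ⟨fun _ => safe_OK_complete, fun e => (e (by simp [e₄])).elim⟩

theorem safe_testTM_complete (h : w.kind n = some (.chan n .pch))
    (h₁ : w.kind n₁ = some (.chan n .bn)) (h₂ : w.kind n₂ = some (.chan n .ba)) :
    Safe (Requirement.TM.completeSetting ρ) (testTM pkA (name n) (name n₁) (name n₂)) w
      {⟨true, n, [(.pch, pkA)]⟩} := by
  refine safe_receive h fun w₁ hw₁ x hx => ?_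
  refine ⟨fun privC ques ans pC ex => ?_, fun e => ?_⟩
  swap
  · obtain ⟨v, -, hv⟩ := evidence_of_sp [_] hx
    simp [Requirement.fullHist, List.suffix_cons_iff] at hv
    exact (e _ _ _ _ hv).elim
  refine safe_receive (World.kind_mono hw₁ h₁) fun w₂ hw₂ y hy => ?_
  refine ⟨fun pE he role spE ey => ?_, fun e => ?_⟩
  swap
  · obtain ⟨v, -, hv⟩ := evidence_of_sp [_, _] hy
    simp [Requirement.fullHist, List.suffix_cons_iff] at hv
    exact (e _ _ _ _ hv.1).elim
  refine safe_receive (World.kind_mono (by order) h₂) fun w₄ hw₄ ema hz => ?_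
  obtain ⟨v, ⟨-, sca', sma, e₃, e₄, e₅⟩, hv⟩ := evidence_of_sp [_, _, _] hz
  simp [Requirement.fullHist, List.suffix_cons_iff] at hv
  obtain ⟨rfl, rfl, rfl⟩ := hv
  obtain ⟨rfl, rfl, rfl, rfl⟩ := tup4_inj.1 ex
  obtain ⟨rfl, rfl, rfl, rfl⟩ := tup4_inj.1 ey
  refine ⟨fun _ _ e => ?_, fun e => (e _ _ e₃).elim⟩
  obtain ⟨rfl, rfl⟩ := tup2_inj.1 (e₃.symm.trans e)
  refine ⟨fun _ _ _ e => ?_, fun e => (e _ _ _ rfl).elim⟩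
  obtain ⟨rfl, rfl, rfl⟩ := tup3_inj.1 e
  refine ⟨fun _ _ _ _ e => ?_, fun e => (e _ _ _ _ rfl).elim⟩
  obtain ⟨rfl, rfl, rfl, rfl⟩ := tup4_inj.1 e
  refine ⟨fun _ _ _ e => ?_, fun e => (e _ _ _ e₅).elim⟩
  obtain ⟨rfl, rfl, rfl⟩ := tup3_inj.1 (e₅.symm.trans e)
  refine ⟨fun _ _ _ _ e => ?_, fun e => (e _ _ _ _ rfl).elim⟩
  obtain ⟨rfl, rfl, rfl, rfl⟩ := tup4_inj.1 e
  refine safe_event (fun _ _ => ev_complete (by nofun)) fun w₆ _ _ => ?_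
  exact ⟨fun _ => safe_OK_complete, fun e => (e (by simp [e₄])).elim⟩

theorem safe_testMI_complete (h : w.kind n = some (.chan n .pch))
    (h₁ : w.kind n₁ = some (.chan n .bn)) (h₂ : w.kind n₂ = some (.chan n .ba)) :
    Safe (Requirement.MI.completeSetting ρ) (testMI pkA (name n) (name n₁) (name n₂)) w
      {⟨true, n, [(.pch, pkA)]⟩} := by
  refine safe_receive h fun w₁ hw₁ x hx => ?_
  refine ⟨fun privC ques ans pC ex => ?_, fun e => ?_⟩
  swap
  · obtain ⟨v, -, hv⟩ := evidence_of_sp [_] hx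
    simp [Requirement.fullHist, List.suffix_cons_iff] at hv
    exact (e _ _ _ _ hv).elim
  refine safe_receive (World.kind_mono hw₁ h₁) fun w₂ hw₂ y hy => ?_
  refine ⟨fun pE he role spE ey => ?_, fun e => ?_⟩
  swap
  · obtain ⟨v, -, hv⟩ := evidence_of_sp [_, _] hy
    simp [Requirement.fullHist, List.suffix_cons_iff] at hv
    exact (e _ _ _ _ hv.1).elim
  refine safe_receive (World.kind_mono (by order) h₂) fun w₄ hw₄ ema hz => ?_
  obtain ⟨v, ⟨-, sca', sma, e₃, e₄, e₅⟩, hv⟩ := evidence_of_sp [_, _, _] hz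
  simp [Requirement.fullHist, List.suffix_cons_iff] at hv
  obtain ⟨rfl, rfl, rfl⟩ := hv
  obtain ⟨rfl, rfl, rfl, rfl⟩ := tup4_inj.1 ex
  obtain ⟨rfl, rfl, rfl, rfl⟩ := tup4_inj.1 ey
  refine ⟨fun _ _ e => ?_, fun e => (e _ _ e₃).elim⟩
  obtain ⟨rfl, rfl⟩ := tup2_inj.1 (e₃.symm.trans e)
  refine ⟨fun _ _ _ e => ?_, fun e => (e _ _ _ rfl).elim⟩
  obtain ⟨rfl, rfl, rfl⟩ := tup3_inj.1 e
  refine ⟨fun _ _ _ _ e => ?_, fun e => (e _ _ _ _ rfl).elim⟩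
  obtain ⟨rfl, rfl, rfl, rfl⟩ := tup4_inj.1 e
  refine ⟨fun _ => ?_, fun e => (e e₄.symm).elim⟩
  refine safe_event (fun _ _ => ev_complete (by nofun)) fun w₅ _ _ => ?_
  refine ⟨fun _ _ _ e => ?_, fun e => (e _ _ _ e₅).elim⟩
  obtain ⟨rfl, rfl, rfl⟩ := tup3_inj.1 (e₅.symm.trans e)
  refine ⟨fun _ _ _ _ e => ?_, fun e => (e _ _ _ _ rfl).elim⟩
  obtain ⟨rfl, rfl, rfl, rfl⟩ := tup4_inj.1 e
  refine safe_event (fun _ _ => ev_complete (by nofun)) fun w₆ _ _ => ?_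
  exact ⟨fun _ => safe_OK_complete, fun e => (e (by simp)).elim⟩

theorem safe_testMNI_complete (h : w.kind n = some (.chan n .pch))
    (h₂ : w.kind n₂ = some (.chan n .ba)) :
    Safe (Requirement.MNI.completeSetting ρ) (testMNI pkA (name n) (name n₁) (name n₂)) w
      {⟨true, n, [(.pch, pkA)]⟩} := by
  refine safe_receive h fun w₁ hw₁ x hx => ?_
  refine ⟨fun privC ques ans pC ex => ?_, fun e => ?_⟩
  swap
  · obtain ⟨v, -, hv⟩ := evidence_of_sp [_] hx
    simp [Requirement.fullHist, List.suffix_cons_iff] at hv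
    exact (e _ _ _ _ hv).elim
  refine safe_receive (World.kind_mono (by order) h₂) fun w₄ hw₄ ema hz => ?_
  obtain ⟨v, ⟨-, sca', sma, e₃, e₄, e₅⟩, hv⟩ := evidence_of_sp [_, _] hz
  simp [Requirement.fullHist, List.suffix_cons_iff] at hv
  obtain ⟨rfl, rfl⟩ := hv
  obtain ⟨rfl, rfl, rfl, rfl⟩ := tup4_inj.1 ex
  refine ⟨fun _ _ e => ?_, fun e => (e _ _ e₃).elim⟩
  obtain ⟨rfl, rfl⟩ := tup2_inj.1 (e₃.symm.trans e)
  refine ⟨fun _ _ _ e => ?_, fun e => (e _ _ _ rfl).elim⟩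
  obtain ⟨rfl, rfl, rfl⟩ := tup3_inj.1 e
  refine ⟨fun _ _ _ _ e => ?_, fun e => (e _ _ _ _ rfl).elim⟩
  obtain ⟨rfl, rfl, rfl, rfl⟩ := tup4_inj.1 e
  refine ⟨fun _ => ?_, fun e => (e e₄.symm).elim⟩
  refine safe_event (fun _ _ => ev_complete (by nofun)) fun w₅ _ _ => ?_
  exact ⟨fun _ => safe_OK_complete, fun e => (e ⟨rfl, rfl⟩).elim⟩

theorem safe_test_complete (h : w.kind n = some (.chan n .pch))
    (h₁ : w.kind n₁ = some (.chan n .bn)) (h₂ : w.kind n₂ = some (.chan n .ba)) :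
    Safe (R.completeSetting ρ) (R.test pkA (name n) (name n₁) (name n₂)) w
      {⟨true, n, [(.pch, pkA)]⟩} := by
  cases R
  exacts [safe_testQV_complete (n₁ := n₁) h h₂, safe_testMC_complete (n₁ := n₁) (n₂ := n₂) h,
    safe_testTI_complete h h₁ h₂, safe_testTM_complete h h₁ h₂, safe_testMI_complete h h₁ h₂,
    safe_testMNI_complete (n₁ := n₁) h h₂]

/-- Histories have the latest message first, so extending to a suffix of the full history means
sending the next message in the prescribed order. The same view and evidence justify all messages of
a session. -/
theorem safe_send_evidence {v : View} {x : Chan} {m : Msg} {l : Hist} {P : Proc}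
    (hv : R.Evidence pkA v) (hn : w.kind n₁ = some (.chan n x)) (hl : (x, m) :: l <:+ R.fullHist v)
    (hP : Safe (R.completeSetting ρ) P w {⟨false, n, ((x, m) :: l) ++ [(.pch, pkA)]⟩}) :
    Safe (R.completeSetting ρ) (.out (name n₁) m P) w {⟨false, n, l ++ [(.pch, pkA)]⟩} :=
  safe_send hn ⟨pkA, (x, m) :: l, v, rfl, hv, hl⟩ hP

theorem safe_Cand_complete (hR : R = .MC → ρ = .correct) {skC pkN ans : Msg}
    (h : w.kind n = some (.chan n .pch))
    (h₁ : w.kind n₁ = some (.chan n .bn)) (h₂ : w.kind n₂ = some (.chan n .ba))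
    (hC : skC.Good (R.completeSetting ρ) w) (hA : pkA.Good (R.completeSetting ρ) w)
    (hN : PubKey w false .net pkN) (hans : ans.Good (R.completeSetting ρ) w) :
    Safe (R.completeSetting ρ) (Cand (R.fullReport (name n) (name n₁) (name n₂)) skC pkA pkN ans) w
      {⟨false, n, [(.pch, pkA)]⟩} := by
  have split : ∀ rq rs rn : Multiset Tok, rq + (rs + rn) = {⟨false, n, [(.pch, pkA)]⟩} →
      (∀ w' ≥ w, ∀ a b c, QuestionOK pkA a b c → Safe (R.completeSetting ρ)
        ((R.fullReport (name n) (name n₁) (name n₂)).question a b c) w' rq) →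
      (∀ w' ≥ w, ∀ a b c d, Safe (R.completeSetting ρ)
        ((R.fullReport (name n) (name n₁) (name n₂)).submission a b c d) w' rs) →
      (∀ w' ≥ w, ∀ v : View, v.OK pkA → (ρ = .correct → v.mark = correct v.ques v.ans) →
        Safe (R.completeSetting ρ)
          ((R.fullReport (name n) (name n₁) (name n₂)).notification v) w' rn) →
      Safe (R.completeSetting ρ)
        (Cand (R.fullReport (name n) (name n₁) (name n₂)) skC pkA pkN ans) w
        {⟨false, n, [(.pch, pkA)]⟩} :=
    fun rq rs rn e hq hs hv => e ▸ safe_Cand (fun _ _ => ev_complete (by nofun)) hC hA hN hans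
      hq hs (fun w' hw v hv' _ hm => hv w' hw v hv' (hm rfl rfl))
  cases R
  case QV =>
    refine split {⟨false, n, [(.pch, pkA)]⟩} 0 0 (by simp) (fun w' hw k q e hq => ?_) (fun _ _ _ _ _ _ => safe_nil)
      fun _ _ _ _ _ => safe_nil
    -- Only the private key, the question and its post matter here; the other fields are filled with
    -- `k`.
    let v : View := ⟨k, k, q, k, k, e, k, k, k, k, k, k⟩
    refine safe_send_evidence (l := []) (v := v) hq (World.kind_mono hw h₂)
      (List.suffix_cons _ _) ?_
    exact safe_send_evidence (v := v) hq (World.kind_mono hw h) List.suffix_rfl safe_nil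
  case MC =>
    exact split 0 0 {⟨false, n, [(.pch, pkA)]⟩} (by simp) (fun _ _ _ _ _ _ => safe_nil) (fun _ _ _ _ _ _ => safe_nil)
      fun w' hw v _ hv => safe_send_evidence (R := .MC) (l := []) (v := v) (hv (hR rfl)) (World.kind_mono hw h)
        List.suffix_rfl safe_nil
  all_goals
    refine split 0 0 {⟨false, n, [(.pch, pkA)]⟩} (by simp) (fun _ _ _ _ _ _ => safe_nil) (fun _ _ _ _ _ _ => safe_nil)
      fun w' hw v hv _ => ?_
    have h' := World.kind_mono hw h
    have h₁' := World.kind_mono hw h₁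
    have h₂' := World.kind_mono hw h₂
  case TI =>
    -- The explicit lists stand for the messages still to be sent.
    exact safe_send_evidence (l := []) hv h' ⟨[_, _, _], rfl⟩ <|
      safe_send_evidence hv h₁' ⟨[_, _], rfl⟩ <| safe_send_evidence hv h₂' ⟨[_], rfl⟩ <|
      safe_send_evidence hv h₂' List.suffix_rfl safe_nil
  case MNI =>
    exact safe_send_evidence (l := []) hv h' ⟨[_], rfl⟩ <|
      safe_send_evidence hv h₂' List.suffix_rfl safe_nil
  all_goals
    exact safe_send_evidence (l := []) hv h' ⟨[_, _], rfl⟩ <|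
      safe_send_evidence hv h₁' ⟨[_], rfl⟩ <| safe_send_evidence hv h₂' List.suffix_rfl safe_nil

theorem not_executes_KO (hR : R = .MC → ρ = .correct) : ¬ Executes (completenessProc R ρ) .KO := by
  rintro ⟨s, hs, e, he, hKO⟩
  obtain ⟨l₁, l₂, hl⟩ := List.append_of_mem he
  refine Safe.ev_of_reaches (σ := R.completeSetting ρ) ?_ hs l₁ _ l₂ hl hKO
  refine safe_exam (σ := R.completeSetting ρ) (fun _ _ => ev_complete (by nofun))
    fun w skC pkA pkN ans hC hA hN hans => ?_
  -- The condition on histories is the same for all sessions, so the key of this exam's authority is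
  -- recorded in the history itself.
  refine safe_new_session [(.pch, pkA)] fun w₁ _ n hn => ?_
  refine safe_new_kind (.chan n .bn) (fun _ => rfl) fun w₂ _ n₁ hn₁ => ?_
  refine safe_new_kind (.chan n .ba) (fun _ => rfl) fun w₃ _ n₂ hn₂ => ?_
  have hn := World.kind_mono (show w₁ ≤ w₃ by order) hn
  have hn₁ := World.kind_mono (show w₂ ≤ w₃ by order) hn₁
  have hw : w ≤ w₃ := by order
  exact ⟨{⟨false, n, [(.pch, pkA)]⟩}, _, by simp, safe_Cand_complete hR hn hn₁ hn₂ (hC.mono hw)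
    (hA.good.mono hw) (hN.mono hw) (hans.mono hw), safe_test_complete hn hn₁ hn₂⟩

end

/-! ### Honest runs that succeed -/

/-- The processes `S` can execute `OK` from given tables and knowledge of the attacker. -/
def Can (S : Multiset Proc) (T : Set (Table × Msg × Msg × Msg)) (K : Set Msg) : Prop :=
  ∀ n L, ∃ s, Relation.ReflTransGen Step ⟨n, S, T, K, L⟩ s ∧ ∃ e ∈ s.log, e.label = .OK

section
variable {S : Multiset Proc} {T : Set (Table × Msg × Msg × Msg)} {K : Set Msg} {P Q P₁ P₂ P₃ P₄ P₅ : Proc}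
  {c m a b d e : Msg}

/-- Runs are built from the goal: a configuration can succeed if a successor can. The name counter
and the log never restrict a step and are therefore left arbitrary. -/
theorem can_of_step {S' : Multiset Proc} {T' : Set (Table × Msg × Msg × Msg)} {K' : Set Msg}
    (hs : ∀ n L, ∃ n' L', Step ⟨n, S, T, K, L⟩ ⟨n', S', T', K', L'⟩) (h : Can S' T' K') :
    Can S T K := fun n L =>
  let ⟨n', L', hs⟩ := hs n L
  let ⟨s, hr, he⟩ := h n' L'
  ⟨s, .head hs hr, he⟩

theorem can_nil (h : Can S T K) : Can (.nil ::ₘ S) T K := can_of_step (fun _ _ => ⟨_, _, .nil⟩) h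

theorem can_par (h : Can (P ::ₘ Q ::ₘ S) T K) : Can (.par P Q ::ₘ S) T K :=
  can_of_step (fun _ _ => ⟨_, _, .par⟩) h

theorem can_repl (h : Can (P ::ₘ .repl P ::ₘ S) T K) : Can (.repl P ::ₘ S) T K :=
  can_of_step (fun _ _ => ⟨_, _, .repl⟩) h

/-- Success does not depend on freshness, so any message may stand for the new name. -/
theorem can_new {P : Msg → Proc} (h : ∀ x, Can (P x ::ₘ S) T K) : Can (.new P ::ₘ S) T K := by
  intro n L
  obtain ⟨s, hr, he⟩ := h (name n) (n + 1) L
  exact ⟨s, .head .new hr, he⟩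

theorem can_comm {Q : Msg → Proc} (h : Can (P ::ₘ Q m ::ₘ S) T K) :
    Can (.out c m P ::ₘ .inp c Q ::ₘ S) T K := can_of_step (fun _ _ => ⟨_, _, .comm⟩) h

/-- Only a lower bound on the attacker's knowledge is kept, which avoids carrying along the list of
all posts. -/
theorem can_recv (hc : Derives K c) (h : ∀ K', K ⊆ K' → m ∈ K' → Can (P ::ₘ S) T K') :
    Can (.out c m P ::ₘ S) T K :=
  can_of_step (fun _ _ => ⟨_, _, .recv hc⟩) (h _ (Set.subset_insert _ _) (Set.mem_insert _ _))

theorem can_send (m : Msg) {P : Msg → Proc} (hc : Derives K c) (hm : Derives K m)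
    (h : Can (P m ::ₘ S) T K) : Can (.inp c P ::ₘ S) T K :=
  can_of_step (fun _ _ => ⟨_, _, .send hc hm⟩) h

theorem can_cond {φ : Prop} (hφ : φ) (h : Can (P ::ₘ S) T K) : Can (.cond φ P Q ::ₘ S) T K :=
  can_of_step (fun _ _ => ⟨_, _, .cond_true hφ⟩) h

theorem can_let2 {P : Msg → Msg → Proc} (e : m = tup2 a b) (h : Can (P a b ::ₘ S) T K) :
    Can (.let2 m P Q ::ₘ S) T K := can_of_step (fun _ _ => ⟨_, _, .let2 e⟩) h

theorem can_let3 {P : Msg → Msg → Msg → Proc} (e : m = tup3 a b c) (h : Can (P a b c ::ₘ S) T K) :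
    Can (.let3 m P Q ::ₘ S) T K := can_of_step (fun _ _ => ⟨_, _, .let3 e⟩) h

theorem can_let4 {P : Msg → Msg → Msg → Msg → Proc} (e : m = tup4 a b c d)
    (h : Can (P a b c d ::ₘ S) T K) : Can (.let4 m P Q ::ₘ S) T K :=
  can_of_step (fun _ _ => ⟨_, _, .let4 e⟩) h

theorem can_event {e : Event} (h : Can (P ::ₘ S) T K) : Can (.event e P ::ₘ S) T K :=
  can_of_step (fun _ _ => ⟨_, _, .event⟩) h

theorem can_insert {t : Table} (h : ∀ T', T ⊆ T' → (t, a, b, c) ∈ T' → Can (P ::ₘ S) T' K) :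
    Can (.insert t a b c P ::ₘ S) T K :=
  can_of_step (fun _ _ => ⟨_, _, .insert⟩) (h _ (Set.subset_insert _ _) (Set.mem_insert _ _))

theorem can_get {t : Table} {φ : Msg → Msg → Msg → Prop} {P : Msg → Msg → Msg → Proc}
    (ht : (t, a, b, c) ∈ T) (hφ : φ a b c) (h : Can (P a b c ::ₘ S) T K) :
    Can (.get t φ P ::ₘ S) T K := can_of_step (fun _ _ => ⟨_, _, .get ht hφ⟩) h

theorem can_OK {args : List Msg} : Can (OK args ::ₘ S) T K := fun n L =>
  ⟨⟨n, .nil ::ₘ S, T, K, ⟨.OK, args⟩ :: L⟩, .single .event, ⟨.OK, args⟩, by simp, rfl⟩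

/-- This and the next three lemmas bring the process that is to act to the front. -/
theorem can_second (h : Can (P₂ ::ₘ P₁ ::ₘ S) T K) : Can (P₁ ::ₘ P₂ ::ₘ S) T K := by
  rwa [Multiset.cons_swap]

theorem can_third (h : Can (P₃ ::ₘ P₁ ::ₘ P₂ ::ₘ S) T K) : Can (P₁ ::ₘ P₂ ::ₘ P₃ ::ₘ S) T K := by
  rwa [Multiset.cons_swap P₂, Multiset.cons_swap P₁]

theorem can_fourth (h : Can (P₄ ::ₘ P₁ ::ₘ P₂ ::ₘ P₃ ::ₘ S) T K) :
    Can (P₁ ::ₘ P₂ ::ₘ P₃ ::ₘ P₄ ::ₘ S) T K := by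
  rwa [Multiset.cons_swap P₃, Multiset.cons_swap P₂, Multiset.cons_swap P₁]

theorem can_fifth (h : Can (P₅ ::ₘ P₁ ::ₘ P₂ ::ₘ P₃ ::ₘ P₄ ::ₘ S) T K) :
    Can (P₁ ::ₘ P₂ ::ₘ P₃ ::ₘ P₄ ::ₘ P₅ ::ₘ S) T K := by
  rwa [Multiset.cons_swap P₄, Multiset.cons_swap P₃, Multiset.cons_swap P₂, Multiset.cons_swap P₁]

theorem can_NET {skN pkA rc R rx pkX : Msg} (ht : (.publickey, R, rx, pkX) ∈ T) (hR : Derives K R)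
    (h : ∀ K', K ⊆ K' →
      tup4 (pseudoPub pkX rx) (exp rx) R (sign (tup3 (pseudoPub pkX rx) (exp rx) R) skN) ∈ K' →
      Can S T K') : Can (NET skN pkA rc ::ₘ S) T K := by
  refine can_send R (.const _) hR (can_get ht rfl (can_recv (.const _) fun K₁ h₁ hm => ?_))
  exact can_new fun r => can_recv (.const _) fun K₂ h₂ _ => can_nil (h K₂ (h₁.trans h₂) (h₂ hm))

/-- The attacker plays the network: he picks up every post and delivers it to its addressee, and all
checks succeed by the equations. The process `P` stands for the submission report, which is left
unused. -/
theorem can_principals {R : Report} {ρ : Marking} {skA skN skC skE rc re ans mark : Msg}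
    (hC : tup4 (pseudoPub (pk skC) rc) (exp rc) roleC
      (sign (tup3 (pseudoPub (pk skC) rc) (exp rc) roleC) skN) ∈ K)
    (hE : tup4 (pseudoPub (pk skE) re) (exp re) roleE
      (sign (tup3 (pseudoPub (pk skE) re) (exp re) roleE) skN) ∈ K)
    (h : ∀ P T' K' v, QuestionOK (pk skA) v.privC v.ques v.eques → v.OK (pk skA) →
      (ρ = .correct → v.mark = correct v.ques v.ans) →
      (.correctAns, v.ques, v.ans, correct v.ques v.ans) ∈ T' →
      Can (R.question v.privC v.ques v.eques ::ₘ R.notification v ::ₘ P ::ₘ S) T' K') :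
    Can (EA skA (pk skN) ::ₘ Cand R skC (pk skA) (pk skN) ans ::ₘ
      Ex ρ skE (pk skA) (pk skN) mark ::ₘ S) T K := by
  -- the question
  refine can_new fun ques => can_event <| can_send _ (.const _) (.known hC) <| can_let4 rfl <|
    can_cond (by simp) <| can_new fun r₁ => can_recv (.const _) fun K₁ h₁ heques => ?_
  have hC := h₁ hC
  have hE := h₁ hE
  refine can_second <| can_send _ (.const _) (.known hC) <| can_let4 rfl <| can_cond (by simp) <|
    can_cond (checkPseudo_pseudo _ _) <| can_send _ (.const _) (.known heques) <|
    can_let2 (decrypt_encrypt_pseudo _ _ _ _) <| can_cond (by simp) <| can_par <| can_second <|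
    can_new fun r₂ => can_recv (.const _) fun K₂ h₂ heca => can_par <| can_fourth ?_
  have hE := h₂ hE
  refine can_send _ (.const _) (.known heca) <| can_let2 (decrypt_encrypt _ _ _) <| can_let3 rfl <|
    can_cond (by simp) <| can_new fun r₃ => can_recv (.const _) fun K₃ h₃ hrec => ?_
  have hE := h₃ hE
  refine can_send _ (.const _) (.known hE) <| can_let4 rfl <| can_cond (by simp) <|
    can_new fun r₄ => can_recv (.const _) fun K₄ h₄ htest => can_fifth ?_
  have hE := h₄ hE
  refine can_send _ (.const _) (.known hE) <| can_let4 rfl <| can_cond (by simp) <|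
    can_cond (checkPseudo_pseudo _ _) <| can_send _ (.const _) (.known htest) <|
    can_let2 (decrypt_encrypt_pseudo _ _ _ _) <| can_let4 rfl <| can_cond (by simp) <|
    can_new fun r₅ => can_recv (.const _) fun K₅ h₅ hema => can_nil ?_
  refine can_send _ (.const _) (.known hema) <| can_let2 (decrypt_encrypt _ _ _) <| can_let3 rfl <|
    can_cond (by simp) <| can_new fun r₆ => can_recv (.const _) fun K₆ h₆ hnot => ?_
  -- Before publishing, the authority waits for an arbitrary message on the network; any name of the
  -- attacker will do.
  refine can_send (.att 0) (.const _) (.att 0) <| can_insert fun T₁ _ hT =>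
    can_recv (.const _) fun K₇ h₇ _ => can_nil <| can_second ?_
  have hrec := h₇ (h₆ (h₅ (h₄ hrec)))
  have hE := h₇ (h₆ (h₅ hE))
  have hnot := h₇ hnot
  refine can_send _ (.const _) (.known hrec) <| can_let2 (decrypt_encrypt_pseudo _ _ _ _) <|
    can_cond (by simp) <| can_send _ (.const _) (.known hnot) <| can_send _ (.const _) (.known hE) <|
    can_let4 rfl <| can_cond (by simp) <| can_let2 (decrypt_encrypt_pseudo _ _ _ _) <|
    can_let3 rfl <| can_cond (by simp) <| can_event <| can_third ?_
  refine h _ _ _ ⟨_, _, _, _, _, _, _, _, _, _, _, _⟩ ⟨_, _, decrypt_encrypt_pseudo _ _ _ _, checksign_sign _ _⟩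
    ⟨⟨_, decrypt_encrypt_pseudo _ _ _ _, checksign_sign _ _⟩,
      _, _, decrypt_encrypt_pseudo _ _ _ _, checksign_sign _ _, checksign_sign_pseudo _ _ _⟩ ?_ hT
  -- For correct marking, the mark given by the examiner is the correct one by definition.
  rintro rfl
  rfl

end

/-! ### From the exam process to a successful test. -/

section
variable {S : Multiset Proc} {T : Set (Table × Msg × Msg × Msg)} {K : Set Msg} {P Q : Proc}
  {c m a b d e : Msg} {R : Requirement} {ρ : Marking}

/-- A step consumes at most two processes and ignores the others; this allows unused copies to be
discarded in `can_drop`. -/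
theorem Step.frame {n n' : ℕ} {S S' : Multiset Proc} {T T' : Set (Table × Msg × Msg × Msg)}
    {K K' : Set Msg} {L L' : List Event} (h : Step ⟨n, S, T, K, L⟩ ⟨n', S', T', K', L'⟩)
    (F : Multiset Proc) : Step ⟨n, S + F, T, K, L⟩ ⟨n', S' + F, T', K', L'⟩ := by
  cases h <;> simp only [Multiset.cons_add] <;> constructor <;> assumption

theorem can_drop (h : Can S T K) : Can (P ::ₘ S) T K := by
  intro n L
  obtain ⟨s, hr, he⟩ := h n L
  refine ⟨⟨s.next, s.procs + {P}, s.tables, s.known, s.log⟩, ?_, he⟩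
  rw [← Multiset.singleton_add, add_comm]
  clear he
  induction hr with
  | refl => exact .refl
  | tail _ hs ih => exact ih.tail (hs.frame {P})

/-- One exam with one candidate and one examiner suffices. The mixnet runs twice, once for each
role. -/
theorem can_exam {report : (pch bn ba : Msg) → Report} {test : (pkA pch bn ba : Msg) → Proc}
    (h : ∀ pkA pch bn ba P T K v, QuestionOK pkA v.privC v.ques v.eques → v.OK pkA →
      (ρ = .correct → v.mark = correct v.ques v.ans) →
      (.correctAns, v.ques, v.ans, correct v.ques v.ans) ∈ T →
      Can ((report pch bn ba).question v.privC v.ques v.eques ::ₘ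
        (report pch bn ba).notification v ::ₘ P ::ₘ test pkA pch bn ba ::ₘ 0) T K) :
    Can (exam .none ρ (fun skC pkA pkN ans => .new fun pch => .new fun bn => .new fun ba =>
      .par (Cand (report pch bn ba) skC pkA pkN ans) (test pkA pch bn ba)) ::ₘ 0) ∅ ∅ := by
  refine can_repl <| can_second <| can_drop <| can_new fun rc => can_new fun re =>
    can_new fun skA => can_recv (.const _) fun K₁ _ _ => can_new fun skN =>
    can_recv (.const _) fun K₂ _ _ => can_par ?_
  -- two mixnets and the exam authority
  refine can_repl <| can_second <| can_repl <| can_second <| can_drop <| can_third <| can_par <|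
    can_repl <| can_second <| can_drop <| can_second <| can_par ?_
  -- the candidate
  refine can_repl <| can_second <| can_drop <| can_new fun skC => can_recv (.const _) fun K₃ _ _ =>
    can_new fun ans => can_insert fun T₁ _ hC => can_new fun pch => can_new fun bn =>
    can_new fun ba => can_par <| can_third <| can_par ?_
  -- the examiner
  refine can_repl <| can_second <| can_drop <| can_second <| can_drop <| can_new fun skE =>
    can_recv (.const _) fun K₄ _ _ => can_new fun mark => can_insert fun T₂ hT hE => ?_
  refine can_fifth <| can_NET (hT hC) (.const _) fun K₅ _ hC' => ?_
  refine can_fifth <| can_NET hE (.const _) fun K₆ hK hE' => ?_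
  exact can_second <| can_fourth <| can_principals (hK hC') hE' fun P T' K' v => h _ _ _ _ _ _ _ _

/-- The candidate's report feeds the test directly on the private channels, and the evidence from
the honest run answers each of its checks. -/
theorem can_test (hR : R = .MC → ρ = .correct) {pkA pch bn ba : Msg} {v : View}
    (hq : QuestionOK pkA v.privC v.ques v.eques) (hv : v.OK pkA)
    (hm : ρ = .correct → v.mark = correct v.ques v.ans)
    (hT : (.correctAns, v.ques, v.ans, correct v.ques v.ans) ∈ T) :
    Can ((R.fullReport pch bn ba).question v.privC v.ques v.eques ::ₘ
      (R.fullReport pch bn ba).notification v ::ₘ P ::ₘ R.test pkA pch bn ba ::ₘ 0) T K := by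
  obtain ⟨sq, pC, q₁, q₂⟩ := hq
  obtain ⟨⟨s, e₁, e₂⟩, s', t, e₃, e₄, e₅⟩ := hv
  cases R
  case QV =>
    exact can_second <| can_drop <| can_second <| can_drop <| can_comm <| can_comm <| can_drop <|
      can_let2 rfl <| can_let2 q₁ <| can_let2 q₂ <| can_cond ⟨rfl, rfl⟩ can_OK
  all_goals refine can_drop <| can_second <| can_drop ?_
  case MC =>
    exact can_comm <| can_drop <| can_let3 rfl <| can_get hT ⟨rfl, rfl⟩ <|
      can_cond (hm (hR rfl)).symm can_OK
  case TI =>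
    exact can_comm <| can_second <| can_let4 rfl <| can_second <| can_comm <| can_second <|
      can_let4 rfl <| can_second <| can_comm <| can_comm <| can_drop <| can_let2 e₁ <|
      can_let3 e₂ <| can_event <| can_let2 e₃ <| can_let3 rfl <| can_let4 rfl <| can_let3 e₅ <|
      can_let4 rfl <| can_event <| can_cond (by simp [e₄]) can_OK
  case TM =>
    exact can_comm <| can_second <| can_let4 rfl <| can_second <| can_comm <| can_second <|
      can_let4 rfl <| can_second <| can_comm <| can_drop <| can_let2 e₃ <| can_let3 rfl <|
      can_let4 rfl <| can_let3 e₅ <| can_let4 rfl <| can_event <| can_cond (by simp [e₄]) can_OK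
  case MI =>
    exact can_comm <| can_second <| can_let4 rfl <| can_second <| can_comm <| can_second <|
      can_let4 rfl <| can_second <| can_comm <| can_drop <| can_let2 e₃ <| can_let3 rfl <|
      can_let4 rfl <| can_cond e₄.symm <| can_event <| can_let3 e₅ <| can_let4 rfl <| can_event <|
      can_cond (by simp) can_OK
  case MNI =>
    exact can_comm <| can_second <| can_let4 rfl <| can_second <| can_comm <| can_drop <|
      can_let2 e₃ <| can_let3 rfl <| can_let4 rfl <| can_cond e₄.symm <| can_event <|
      can_cond ⟨rfl, rfl⟩ can_OK

theorem executes_OK (hR : R = .MC → ρ = .correct) : Executes (completenessProc R ρ) .OK :=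
  -- Counter `0` and the empty log give the initial configuration.
  can_exam (report := R.fullReport) (test := R.test)
    (fun _ _ _ _ _ _ _ _ => can_test hR) 0 []

theorem complete (hR : R = .MC → ρ = .correct) : Complete R ρ :=
  ⟨not_executes_KO hR, executes_OK hR⟩

end
end Remark

open Remark
theorem mainTheorem3 :
    -- Question Validity, with an honest exam authority
    ((∀ (κ : Corruption) (ρ : Marking), κ.ea = false → ∀ q : Msg,
        Corresponds (soundnessProc .QV κ ρ) ⟨.OK, [q]⟩ ⟨.generated, [q]⟩) ∧
      ∀ ρ : Marking, Complete .QV ρ) ∧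
    -- Marking Correctness, with an honest exam authority
    ((∀ (κ : Corruption) (ρ : Marking), κ.ea = false → ∀ q a m : Msg,
        Corresponds (soundnessProc .MC κ ρ) ⟨.OK, [q, a, m]⟩ ⟨.correct, [q, a, m]⟩ ∧
        ∀ s, Reaches (soundnessProc .MC κ ρ) s → ⟨.OK, [q, a, m]⟩ ∈ s.log → Msg.correct q a = m) ∧
      Complete .MC .correct) ∧
    -- Test Integrity
    ((∀ (κ : Corruption) (ρ : Marking) (i q a : Msg),
        Corresponds (soundnessProc .TI κ ρ) ⟨.OK, [i, q, a]⟩ ⟨.marked, [i, q, a]⟩ ∧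
        Corresponds (soundnessProc .TI κ ρ) ⟨.OK, [i, q, a]⟩ ⟨.accepted, [i, q, a]⟩) ∧
      ∀ ρ : Marking, Complete .TI ρ) ∧
    -- Test Markedness
    ((∀ (κ : Corruption) (ρ : Marking) (i q a : Msg),
        Corresponds (soundnessProc .TM κ ρ) ⟨.OK, [i, q, a]⟩ ⟨.marked, [i, q, a]⟩) ∧
      ∀ ρ : Marking, Complete .TM ρ) ∧
    -- Mark Integrity
    ((∀ (κ : Corruption) (ρ : Marking) (i q a m : Msg),
        Corresponds (soundnessProc .MI κ ρ) ⟨.OK, [i, q, a, m]⟩ ⟨.marked, [i, q, a, m]⟩ ∧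
        Corresponds (soundnessProc .MI κ ρ) ⟨.OK, [i, q, a, m]⟩ ⟨.assigned, [i, q, a, m]⟩) ∧
      ∀ ρ : Marking, Complete .MI ρ) ∧
    -- Mark Notification Integrity
    ((∀ (κ : Corruption) (ρ : Marking) (i m : Msg),
        Corresponds (soundnessProc .MNI κ ρ) ⟨.OK, [i, m]⟩ ⟨.assigned, [i, m]⟩) ∧
      ∀ ρ : Marking, Complete .MNI ρ) := by

  refine ⟨⟨fun κ ρ hκ q s hs l₁ l₂ hl => sound_of_reaches hs hl hκ q rfl,
      fun ρ => complete nofun⟩,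
    ⟨fun κ ρ _ q a m => ⟨fun s hs l₁ l₂ hl => (sound_of_reaches hs hl q a m rfl).1,
      fun s hs he => ?_⟩, complete fun _ => rfl⟩,
    ⟨fun κ ρ i q a => ⟨fun s hs l₁ l₂ hl => (sound_of_reaches hs hl i q a rfl).1,
      fun s hs l₁ l₂ hl => (sound_of_reaches hs hl i q a rfl).2⟩, fun ρ => complete nofun⟩,
    ⟨fun κ ρ i q a s hs l₁ l₂ hl => sound_of_reaches hs hl i q a rfl, fun ρ => complete nofun⟩,
    ⟨fun κ ρ i q a m => ⟨fun s hs l₁ l₂ hl => (sound_of_reaches hs hl i q a m rfl).1,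
      fun s hs l₁ l₂ hl => (sound_of_reaches hs hl i q a m rfl).2⟩, fun ρ => complete nofun⟩,
    ⟨fun κ ρ i m s hs l₁ l₂ hl => sound_of_reaches hs hl i m rfl, fun ρ => complete nofun⟩⟩
  -- The equation of the marks belongs to one execution of `OK`, so the log is split there.
  obtain ⟨l₁, l₂, hl⟩ := List.append_of_mem he
  exact (sound_of_reaches hs hl q a m rfl).2
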